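/- Let $n\ge 1$, $m\ge 2$, $0<\kappa<1$, $\Phi(t)=t(1+\log^+t)$ with $\log^+t=\max\{\log t,0\}$, and let $\Phi^{(m)}$ be the $m$-fold composition of $\Phi$ with itself. Balls are the balls $B\subset\mathbb R^n$. A weight is a nonnegative locally integrable function on $\mathbb R^n$ that is positive almost everywhere, and $\omega(S)=\int_S\omega\,dx$. For a weight $\omega$ put $$\|g\|_{L\log L(\omega),B}=\inf\Big\{\sigma>0:\tfrac1{\omega(B)}\int_B\Phi\big(|g|/\sigma\big)\,\omega\,dx\le1\Big\},\qquad \|g\|_{(L\log L)^{1,\kappa}(\omega)}=\sup_B\omega(B)^{1-\kappa}\|g\|_{L\log L(\omega),B}.$$ Let $\vec\omega=(\omega_1,\dots,\omega_m)$ be weights, $\nu_{\vec\omega}=\prod_{i=1}^m\omega_i^{1/m}$, such that $\vec\omega\in A_{(1,\dots,1)}$, i.e. $\sup_B\big(\frac1{|B|}\int_B\nu_{\vec\omega}\big)^m\prod_{i=1}^m(\operatorname{ess\,inf}_B\omega_i)^{-1}<\infty$, and such that every $\omega_i$ belongs to $A_\infty=\bigcup_{1\le p<\infty}A_p$. Let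 $X$ be a complex Banach space and let $Q(x,\vec y)$, for $x\in\mathbb R^n$ and $\vec y=(y_1,\dots,y_m)\in(\mathbb R^n)^m$ with not all $y_j$ equal to $x$, be bounded linear operators $\mathbb C\to X$, measurable in $\vec y$, with the size condition $\|Q(x,\vec y)\|\le A\,\big(\sum_{j=1}^m|x-y_j|\big)^{-mn}$. For $\vec b=(b_1,\dots,b_m)\in(\mathrm{BMO})^m$ put $\|\vec b\|=\max_N\|b_N\|_{\mathrm{BMO}}$ and define the commutators $$T_{\vec b}(\vec f)(x)=\sum_{N=1}^m\Big\|\int_{(\mathbb R^n)^m}Q(x,\vec y)\Big((b_N(x)-b_N(y_N))\prod_{j=1}^mf_j(y_j)\Big)d\vec y\Big\|_X,$$ $$T_{\prod\vec b}(\vec f)(x)=\Big\|\int_{(\mathbb R^n)^m}Q(x,\vec y)\Big(\prod_{j=1}^m(b_j(x)-b_j(y_j))f_j(y_j)\Big)d\vec y\Big\|_X.$$ Here, for each $x$, the integral $F\mapsto\int Q(x,\vec y)(F(\vec y))\,d\vec y$ is the absolutely convergent (Bochner) integral or any fixed linear extension of it to a larger space of functions $F$ (for instance a principal value or, for $X=L^2((0,\infty),dt/t)$,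 the integral taken for almost every $t$ separately); the norm is $\infty$ where the integral is not defined. (i) Suppose that, with a constant $C_0$, for all measurable $\vec f$ and all $\lambda>0$, $$\big[\nu_{\vec\omega}(\{x\in\mathbb R^n:T_{\vec b}(\vec f)(x)>\lambda^m\})\big]^m\le C_0\,\Phi(\|\vec b\|)\prod_{k=1}^m\int_{\mathbb R^n}\Phi\Big(\frac{|f_k|}\lambda\Big)\omega_k\,dx .$$ Then for all measurable $\vec f$, all $\lambda>0$ and all balls $B$, $$\nu_{\vec\omega}(B)^{-m\kappa}\big[\nu_{\vec\omega}(\{x\in B:T_{\vec b}(\vec f)(x)>\lambda^m\})\big]^m\le C\,\Phi(\|\vec b\|)\prod_{i=1}^m\Big\|\Phi\Big(\frac{|f_i|}\lambda\Big)\Big\|_{(L\log L)^{1,\kappa}(\omega_i)},$$ where $C$ depends only on $n,m,\kappa,\vec\omega,A,C_0$. (ii) Suppose that, with a constant $C_0$, for all measurable $\vec f$ and all $\lambda>0$, $$\big[\nu_{\vec\omega}(\{x\in\mathbb R^n:T_{\prod\vec b}(\vec f)(x)>\lambda^m\})\big]^m\le C_0\prod_{k=1}^m\int_{\mathbb R^n}\Phi^{(m)}\Big(\frac{|f_k|}\lambda\Big)\omega_k\,dx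 .$$ Then for all measurable $\vec f$, all $\lambda>0$ and all balls $B$, $$\nu_{\vec\omega}(B)^{-m\kappa}\big[\nu_{\vec\omega}(\{x\in B:T_{\prod\vec b}(\vec f)(x)>\lambda^m\})\big]^m\le C\prod_{i=1}^m\Big\|\Phi^{(m)}\Big(\frac{|f_i|}\lambda\Big)\Big\|_{(L\log L)^{1,\kappa}(\omega_i)},$$ where $C$ depends only on $n,m,\kappa,\vec\omega,A,C_0$ and an upper bound for $\|\vec b\|$. -/

import Mathlib

open MeasureTheory
open scoped ENNReal NNReal

namespace MorreyLLogL

/-- Euclidean space `ℝⁿ`. -/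
abbrev E (n : ℕ) : Type := EuclideanSpace ℝ (Fin n)

/-! ### Weights -/

/-- A weight: a nonnegative locally integrable function that is positive almost everywhere. -/
structure IsWeight {n : ℕ} (w : E n → ℝ) : Prop where
  nonneg : ∀ x, 0 ≤ w x
  locallyIntegrable : LocallyIntegrable w volume
  ae_pos : ∀ᵐ x, 0 < w x

/-- The measure `w(S) = ∫_S w(x) dx`. -/
noncomputable def wMeasure {n : ℕ} (w : E n → ℝ) : Measure (E n) :=
  (volume : Measure (E n)).withDensity fun x => ENNReal.ofReal (w x)

/-- The average `|B|⁻¹ ∫_B g(x) dx` over the ball `B = B(c, r)`. -/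
noncomputable def ballAvg {n : ℕ} (g : E n → ℝ≥0∞) (c : E n) (r : ℝ) : ℝ≥0∞ :=
  (volume (Metric.ball c r))⁻¹ * ∫⁻ x in Metric.ball c r, g x

/-- The essential infimum of a weight over the ball `B(c, r)`. -/
noncomputable def ballEssInf {n : ℕ} (w : E n → ℝ) (c : E n) (r : ℝ) : ℝ≥0∞ :=
  essInf (fun x => ENNReal.ofReal (w x)) (volume.restrict (Metric.ball c r))

/-- The Muckenhoupt class `A₁`. -/
def IsA1 {n : ℕ} (w : E n → ℝ) : Prop :=
  IsWeight w ∧ ∃ C : ℝ≥0, ∀ (c : E n) (r : ℝ), 0 < r →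
    ballAvg (fun x => ENNReal.ofReal (w x)) c r ≤ C * ballEssInf w c r

/-- The Muckenhoupt class `A_p`, for `1 < p < ∞`. -/
def IsAp {n : ℕ} (p : ℝ) (w : E n → ℝ) : Prop :=
  IsWeight w ∧ ∃ C : ℝ≥0, ∀ (c : E n) (r : ℝ), 0 < r →
    ballAvg (fun x => ENNReal.ofReal (w x)) c r *
      (ballAvg (fun x => ENNReal.ofReal (w x) ^ (-1 / (p - 1))) c r) ^ (p - 1) ≤ C

/-- `A_∞` is the union of the classes `A_p`, `1 ≤ p < ∞`. -/
def IsAInfty {n : ℕ} (w : E n → ℝ) : Prop :=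
  IsA1 w ∨ ∃ p : ℝ, 1 < p ∧ IsAp p w

/-- For exponents `p₁ = ⋯ = p_m = 1` and `p = 1/m`, the weight `ν = ∏ᵢ wᵢ ^ (p / pᵢ)`, which is
`∏ᵢ wᵢ ^ (1 / m)`. -/
noncomputable def nu {n m : ℕ} (w : Fin m → E n → ℝ) (x : E n) : ℝ :=
  ∏ i, w i x ^ (1 / (m : ℝ))

/-- The multiple weight class `A_{(1, …, 1)}`:
`sup_B (|B|⁻¹ ∫_B ν)^m ∏ᵢ (ess inf_B wᵢ)⁻¹ < ∞`. -/
def IsMultiA1 {n m : ℕ} (w : Fin m → E n → ℝ) : Prop :=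
  (∀ i, IsWeight (w i)) ∧ ∃ C : ℝ≥0, ∀ (c : E n) (r : ℝ), 0 < r →
    (ballAvg (fun x => ENNReal.ofReal (nu w x)) c r) ^ m * ∏ i, (ballEssInf (w i) c r)⁻¹ ≤ C

/-! ### BMO -/

/-- `‖b‖_BMO = sup_B |B|⁻¹ ∫_B |b(x) - b_B| dx`, with values in `[0, ∞]`. -/
noncomputable def bmoNorm {n : ℕ} (b : E n → ℂ) : ℝ≥0∞ :=
  ⨆ (c : E n) (r : ℝ) (_ : 0 < r),
    ballAvg (fun x => ‖b x - ⨍ y in Metric.ball c r, b y‖ₑ) c r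

/-- Functions of bounded mean oscillation. -/
def IsBMO {n : ℕ} (b : E n → ℂ) : Prop :=
  LocallyIntegrable b volume ∧ bmoNorm b < ⊤

/-- `‖(b₁, …, b_m)‖_{BMO^m} = sup_N ‖b_N‖_BMO`. -/
noncomputable def bmoNormVec {n m : ℕ} (b : Fin m → E n → ℂ) : ℝ :=
  (⨆ N, bmoNorm (b N)).toReal

/-! ### The Young function and the Morrey norm of `L log L` type -/

/-- `Φ(t) = t (1 + log⁺ t)`. -/
noncomputable def Phi (t : ℝ) : ℝ := t * (1 + max (Real.log t) 0)

/-- The weighted Luxemburg norm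
`‖g‖_{L log L(w), B} = inf {σ > 0 : w(B)⁻¹ ∫_B Φ(|g| / σ) w dx ≤ 1}`, with values in `[0, ∞]`. -/
noncomputable def luxNorm {n : ℕ} (w : E n → ℝ) (g : E n → ℝ) (c : E n) (r : ℝ) : ℝ≥0∞ :=
  ⨅ (σ : ℝ≥0) (_ : 0 < σ)
    (_ : (wMeasure w (Metric.ball c r))⁻¹ *
      ∫⁻ x in Metric.ball c r, ENNReal.ofReal (Phi (|g x| / σ)) ∂(wMeasure w) ≤ 1), (σ : ℝ≥0∞)

/-- `‖g‖_{(L log L)^{1,κ}(w)} = sup_B w(B)^(1 - κ) ‖g‖_{L log L(w), B}`. -/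
noncomputable def morreyLLogL {n : ℕ} (κ : ℝ) (w : E n → ℝ) (g : E n → ℝ) : ℝ≥0∞ :=
  ⨆ (c : E n) (r : ℝ) (_ : 0 < r),
    wMeasure w (Metric.ball c r) ^ (1 - κ) * luxNorm w g c r

/-! ### Vector-valued kernels and the commutators -/

section Operators

variable {n m : ℕ} {X : Type*} [NormedAddCommGroup X] [NormedSpace ℂ X]

/-- The size condition with constant `A`, together with measurability in `y`. The value of the
kernel on the diagonal `x = y₁ = ⋯ = y_m` is irrelevant. -/
structure IsSizeKernel (A : ℝ) (Q : E n → (Fin m → E n) → (ℂ →L[ℂ] X)) : Prop where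
  measurable : ∀ x, AEStronglyMeasurable (Q x) volume
  size : ∀ x y, (∃ j, y j ≠ x) → ‖Q x y‖ ≤ A / (∑ j, ‖x - y j‖) ^ (m * n)

/-- For fixed `x`, the partially defined linear map `F ↦ ∫ Q(x, y)(F(y)) dy` whose domain consists
of the functions `F` for which the (Bochner) integral converges absolutely. -/
noncomputable def kernelIntegral (Q : E n → (Fin m → E n) → (ℂ →L[ℂ] X)) (x : E n) :
    ((Fin m → E n) → ℂ) →ₗ.[ℂ] X where
  domain :=
    { carrier := {F | Integrable (fun y => Q x y (F y)) volume}
      add_mem' := fun {F G} hF hG => by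
        have h := Integrable.add hF hG
        refine h.congr (Filter.Eventually.of_forall fun y => ?_)
        simp
      zero_mem' := by simp
      smul_mem' := fun a F hF => by
        have h := Integrable.smul a hF
        refine h.congr (Filter.Eventually.of_forall fun y => ?_)
        simp only [Pi.smul_apply, map_smul] }
  toFun :=
    { toFun := fun F => ∫ y, Q x y (F.1 y)
      map_add' := fun F G => by
        have h := integral_add F.2 G.2
        simpa using h
      map_smul' := fun a F => by
        have h := integral_smul a (fun y => Q x y (F.1 y)) (μ := volume)
        simpa only [SetLike.val_smul, Pi.smul_apply, map_smul, RingHom.id_apply] using h }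

/-- An admissible meaning of the expressions `∫ Q(x, y)(F(y)) dy`: for every `x`, a linear map on
some space of functions `F` that extends the absolutely convergent integral. Besides that integral
itself, this allows conditionally convergent ones: principal values, or, for
`X = L²((0, ∞), dt/t)`, the integral in `y` taken separately for almost every `t`. -/
def IsIntegralExtension (Q : E n → (Fin m → E n) → (ℂ →L[ℂ] X))
    (J : E n → ((Fin m → E n) → ℂ) →ₗ.[ℂ] X) : Prop :=
  ∀ x, kernelIntegral Q x ≤ J x

open Classical in
/-- The norm of the value of a partially defined linear map, `∞` where there is no value. -/
noncomputable def valueNorm (L : ((Fin m → E n) → ℂ) →ₗ.[ℂ] X) (F : (Fin m → E n) → ℂ) : ℝ≥0∞ :=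
  if h : F ∈ L.domain then ‖L ⟨F, h⟩‖ₑ else ⊤

/-- The `N`-th commutator
`T_b^N(f)(x) = ‖∫ Q(x, y)((b_N(x) - b_N(y_N)) ∏ⱼ fⱼ(yⱼ)) dy‖_X`. -/
noncomputable def commN (J : E n → ((Fin m → E n) → ℂ) →ₗ.[ℂ] X) (b : Fin m → E n → ℂ)
    (N : Fin m) (f : Fin m → E n → ℂ) (x : E n) : ℝ≥0∞ :=
  valueNorm (J x) fun y => (b N x - b N (y N)) * ∏ j, f j (y j)

/-- The commutator `T_b = ∑_N T_b^N`. -/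
noncomputable def comm (J : E n → ((Fin m → E n) → ℂ) →ₗ.[ℂ] X) (b : Fin m → E n → ℂ)
    (f : Fin m → E n → ℂ) (x : E n) : ℝ≥0∞ :=
  ∑ N, commN J b N f x

/-- The iterated commutator
`T_{Πb}(f)(x) = ‖∫ Q(x, y)(∏ⱼ (bⱼ(x) - bⱼ(yⱼ)) fⱼ(yⱼ)) dy‖_X`. -/
noncomputable def iterComm (J : E n → ((Fin m → E n) → ℂ) →ₗ.[ℂ] X) (b : Fin m → E n → ℂ)
    (f : Fin m → E n → ℂ) (x : E n) : ℝ≥0∞ :=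
  valueNorm (J x) fun y => ∏ j, (b j x - b j (y j)) * f j (y j)

end Operators

/-! ### The weak-type estimates, for an operator `S` from `m`-tuples to functions -/

/-- The weak-type estimate on weighted Lebesgue spaces
`[ν{x : S(f)(x) > λ^m}]^m ≤ K ∏ₖ ∫ Ψ(|fₖ| / λ) wₖ dx` for all `f` and all `λ > 0`. -/
def LebesgueWeakType {n m : ℕ} (w : Fin m → E n → ℝ) (Ψ : ℝ → ℝ) (K : ℝ≥0∞)
    (S : (Fin m → E n → ℂ) → E n → ℝ≥0∞) : Prop :=
  ∀ f : Fin m → E n → ℂ, (∀ k, AEStronglyMeasurable (f k) volume) → ∀ l : ℝ, 0 < l →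
    (wMeasure (nu w) {x | ENNReal.ofReal (l ^ m) < S f x}) ^ m ≤
      K * ∏ k, ∫⁻ x, ENNReal.ofReal (Ψ (‖f k x‖ / l)) ∂(wMeasure (w k))

/-- The localized weak-type estimate
`ν(B)^(-mκ) [ν{x ∈ B : S(f)(x) > λ^m}]^m ≤ K ∏ᵢ ‖Ψ(|fᵢ| / λ)‖_{(L log L)^{1,κ}(wᵢ)}` for all `f`,
all `λ > 0` and all balls `B`. -/
def MorreyWeakType {n m : ℕ} (κ : ℝ) (w : Fin m → E n → ℝ) (Ψ : ℝ → ℝ) (K : ℝ≥0∞)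
    (S : (Fin m → E n → ℂ) → E n → ℝ≥0∞) : Prop :=
  ∀ f : Fin m → E n → ℂ, (∀ k, AEStronglyMeasurable (f k) volume) → ∀ l : ℝ, 0 < l →
    ∀ (c : E n) (r : ℝ), 0 < r →
      wMeasure (nu w) (Metric.ball c r) ^ (-((m : ℝ) * κ)) *
          (wMeasure (nu w) {x | x ∈ Metric.ball c r ∧ ENNReal.ofReal (l ^ m) < S f x}) ^ m ≤
        K * ∏ i, morreyLLogL κ (w i) (fun x => Ψ (‖f i x‖ / l))

end MorreyLLogL

/-! Fix a ball `B` of radius `r`, put `V = ν(B)`, and cut the integration domain into `(2B)^m` and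
its complement. The extended integral is linear and agrees with the Bochner integral where the
latter converges absolutely. So `T(f)` is at most `T(f 1_{2B})` plus the absolute integral over the
complement, and both terms are tested at height `(λ/2)^m`.

The local term is handled by the assumed weak-type bound. The remaining integrals over `2B` are at
most `w_i(2B)` times the Luxemburg norm, that is `w_i(2B)^κ` times the Morrey norm. The `A_∞`
hypothesis gives `∏ w_i(B) ≤ C ν(B)^m` (`exists_prod_wMeasure_ball_le`), and `ν` is doubling, so
these powers recombine into `V^{mκ}`.

For the far term take `x ∈ B` and decompose into shells `(2^{j+2}B)^m \ (2^{j+1}B)^m`, on which the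
kernel is at most a constant times `|2^{j+2}B|^{-m}`. Young's inequality for the pair `t log t`,
`exp`, together with John-Nirenberg, bounds each factor carrying a symbol by `j + 3` times `|b_i(x)
- (b_i)_B| + M`, times a weighted Luxemburg norm divided by an essential infimum. The multiple
weight condition turns the volumes and infima into `ν(2^{j+2}B)^{-m}`, leaving
`ν(2^{j+2}B)^{m(κ-1)}`. The condition also makes `ν` an `A₁` weight, hence reverse doubling. As `κ <
1`, this power decays geometrically in `j` and beats the polynomial `(j+3)^m`
(`exists_tsum_far_le`).

What is left is a level set in `x` of a sum or product of the functions `|b_i(x) - (b_i)_B| + M`.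
Their `ν`-means over `B` are controlled by John-Nirenberg for `A₁` measures
(`exists_john_nirenberg`). Chebyshev finishes the sum; for the product, Hölder is applied after
taking `m`-th roots. The factor `λ^m` cancels because `|f| ≤ λ Φ^{(k)}(|f|/λ)`. -/

namespace MorreyLLogL

/-! ### Weighted measures of balls, the `A₁` property of `ν`, products of `A_∞` weights. -/

section Weights

variable {n m : ℕ}

theorem volume_ball_ne_zero (c : E n) {r : ℝ} (hr : 0 < r) :
    volume (Metric.ball c r) ≠ 0 := (Metric.measure_ball_pos volume c hr).ne'

theorem volume_ball_ne_top (c : E n) (r : ℝ) : volume (Metric.ball c r) ≠ ⊤ :=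
  measure_ball_lt_top.ne

theorem volume_ball_mul (c : E n) {k : ℝ} (hk : 0 < k) (r : ℝ) :
    volume (Metric.ball c (k * r)) = ENNReal.ofReal (k ^ n) * volume (Metric.ball c r) := by
  rw [Measure.addHaar_ball_mul_of_pos _ _ hk, Measure.addHaar_ball_center volume c]
  simp

theorem ballAvg_eq_lintegral (g : E n → ℝ≥0∞) (c : E n) (r : ℝ) :
    ballAvg g c r =
      ∫⁻ x, g x ∂((volume (Metric.ball c r))⁻¹ • volume.restrict (Metric.ball c r)) := by
  rw [lintegral_smul_measure, ballAvg, smul_eq_mul]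

theorem IsWeight.aemeasurable {w : E n → ℝ} (hw : IsWeight w) :
    AEMeasurable (fun x => ENNReal.ofReal (w x)) volume :=
  hw.locallyIntegrable.aestronglyMeasurable.aemeasurable.ennreal_ofReal

theorem wMeasure_apply {w : E n → ℝ} {S : Set (E n)} (hS : MeasurableSet S) :
    wMeasure w S = ∫⁻ x in S, ENNReal.ofReal (w x) := withDensity_apply _ hS

theorem ballAvg_weight (w : E n → ℝ) (c : E n) (r : ℝ) :
    ballAvg (fun x => ENNReal.ofReal (w x)) c r =
      (volume (Metric.ball c r))⁻¹ * wMeasure w (Metric.ball c r) := by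
  rw [ballAvg, wMeasure_apply measurableSet_ball]

theorem wMeasure_ball_eq_volume_mul (w : E n → ℝ) (c : E n) {r : ℝ} (hr : 0 < r) :
    wMeasure w (Metric.ball c r) =
      volume (Metric.ball c r) * ballAvg (fun x => ENNReal.ofReal (w x)) c r := by
  rw [ballAvg_weight, ← mul_assoc,
    ENNReal.mul_inv_cancel (volume_ball_ne_zero c hr) (volume_ball_ne_top c r), one_mul]

theorem IsWeight.wMeasure_ball_ne_top {w : E n → ℝ} (hw : IsWeight w) (c : E n) (r : ℝ) :
    wMeasure w (Metric.ball c r) ≠ ⊤ := by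
  rw [wMeasure_apply measurableSet_ball]
  have h : IntegrableOn w (Metric.ball c r) :=
    (hw.locallyIntegrable.integrableOn_isCompact (isCompact_closedBall c r)).mono_set
      Metric.ball_subset_closedBall
  refine (lt_of_le_of_lt (lintegral_mono fun x => ?_) h.2).ne
  rw [← ofReal_norm]
  exact ENNReal.ofReal_le_ofReal (Real.le_norm_self _)

theorem wMeasure_ball_ne_zero {w : E n → ℝ} (hw : ∀ᵐ x, 0 < w x)
    (hm : AEMeasurable (fun x => ENNReal.ofReal (w x)) volume) (c : E n) {r : ℝ} (hr : 0 < r) :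
    wMeasure w (Metric.ball c r) ≠ 0 := by
  rw [wMeasure_apply measurableSet_ball]
  intro h
  rw [lintegral_eq_zero_iff' hm.restrict] at h
  have h2 : ∀ᵐ x ∂(volume.restrict (Metric.ball c r)), False := by
    filter_upwards [h, ae_restrict_of_ae hw] with x hx hx'
    simp only [Pi.zero_apply, ENNReal.ofReal_eq_zero] at hx
    linarith
  rw [Filter.eventually_false_iff_eq_bot, ae_eq_bot, Measure.restrict_eq_zero] at h2
  exact volume_ball_ne_zero c hr h2

theorem lintegral_wMeasure {w : E n → ℝ}
    (hm : AEMeasurable (fun x => ENNReal.ofReal (w x)) volume) (c : E n) (r : ℝ)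
    {g : E n → ℝ≥0∞} (hg : AEMeasurable g volume) :
    ∫⁻ x in Metric.ball c r, g x ∂(wMeasure w) =
      ∫⁻ x in Metric.ball c r, ENNReal.ofReal (w x) * g x := by
  rw [wMeasure, restrict_withDensity measurableSet_ball,
    lintegral_withDensity_eq_lintegral_mul₀ hm.restrict hg.restrict]
  rfl

theorem ae_ballEssInf_le (w : E n → ℝ) (c : E n) (r : ℝ) :
    ∀ᵐ x ∂(volume.restrict (Metric.ball c r)), ballEssInf w c r ≤ ENNReal.ofReal (w x) :=
  ae_essInf_le

/-- The bridge from Lebesgue integrals, in which the kernel estimate is expressed, to weighted ones,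
at the price of an inverse essential infimum. -/
theorem ballEssInf_mul_lintegral_le {w : E n → ℝ}
    (hm : AEMeasurable (fun x => ENNReal.ofReal (w x)) volume) (c : E n) (r : ℝ)
    {g : E n → ℝ≥0∞} (hg : AEMeasurable g volume) :
    ballEssInf w c r * ∫⁻ x in Metric.ball c r, g x ≤
      ∫⁻ x in Metric.ball c r, g x ∂(wMeasure w) := by
  rw [lintegral_wMeasure hm c r hg, ← lintegral_const_mul'' _ hg.restrict]
  refine lintegral_mono_ae ?_
  filter_upwards [ae_ballEssInf_le w c r] with x hx
  gcongr

theorem ballEssInf_mul_volume_le {w : E n → ℝ}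
    (hm : AEMeasurable (fun x => ENNReal.ofReal (w x)) volume) (c : E n) (r : ℝ) :
    ballEssInf w c r * volume (Metric.ball c r) ≤ wMeasure w (Metric.ball c r) := by
  simpa using ballEssInf_mul_lintegral_le hm c r (g := fun _ => 1) aemeasurable_const

theorem IsWeight.ballEssInf_ne_top {w : E n → ℝ} (hw : IsWeight w) (c : E n) {r : ℝ}
    (hr : 0 < r) : ballEssInf w c r ≠ ⊤ := by
  intro h
  have h1 := ballEssInf_mul_volume_le hw.aemeasurable c r
  rw [h, ENNReal.top_mul (volume_ball_ne_zero c hr), top_le_iff] at h1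
  exact hw.wMeasure_ball_ne_top c r h1

/-! ### The weight `ν` -/

theorem ofReal_nu {w : Fin m → E n → ℝ} {x : E n} (hx : ∀ i, 0 ≤ w i x) :
    ENNReal.ofReal (nu w x) = ∏ i, ENNReal.ofReal (w i x) ^ (1 / (m : ℝ)) := by
  rw [nu, ENNReal.ofReal_prod_of_nonneg fun i _ => Real.rpow_nonneg (hx i) _]
  refine Finset.prod_congr rfl fun i _ => ?_
  rw [ENNReal.ofReal_rpow_of_nonneg (hx i) (by positivity)]

theorem ofReal_nu_pow (hm : m ≠ 0) {w : Fin m → E n → ℝ} {x : E n} (hx : ∀ i, 0 ≤ w i x) :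
    ENNReal.ofReal (nu w x) ^ m = ∏ i, ENNReal.ofReal (w i x) := by
  rw [ofReal_nu hx, ← Finset.prod_pow]
  refine Finset.prod_congr rfl fun i _ => ?_
  rw [← ENNReal.rpow_natCast, ← ENNReal.rpow_mul, one_div,
    inv_mul_cancel₀ (Nat.cast_ne_zero.mpr hm), ENNReal.rpow_one]

theorem aemeasurable_nu {w : Fin m → E n → ℝ} (hw : ∀ i, IsWeight (w i)) :
    AEMeasurable (fun x => ENNReal.ofReal (nu w x)) volume := by
  have h : (fun x => ENNReal.ofReal (nu w x)) =
      fun x => ∏ i, ENNReal.ofReal (w i x) ^ (1 / (m : ℝ)) :=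
    funext fun x => ofReal_nu fun i => (hw i).nonneg x
  rw [h]
  exact Finset.aemeasurable_fun_prod _ fun i _ => (hw i).aemeasurable.pow_const _

theorem nu_ae_pos {w : Fin m → E n → ℝ} (hw : ∀ i, IsWeight (w i)) : ∀ᵐ x, 0 < nu w x := by
  have h : ∀ᵐ x, ∀ i, 0 < w i x := ae_all_iff.mpr fun i => (hw i).ae_pos
  filter_upwards [h] with x hx
  exact Finset.prod_pos fun i _ => Real.rpow_pos_of_pos (hx i) _

/-- The infima are finite, so the inverses can be cleared. Enlarging the constant to at least 1
permits `C ≤ C ^ m` when an `m`-th root is taken later. -/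
theorem IsMultiA1.exists_ballAvg_pow_le {w : Fin m → E n → ℝ} (hw : IsMultiA1 w) :
    ∃ C : ℝ≥0, 1 ≤ C ∧ ∀ (c : E n) (r : ℝ), 0 < r →
      (ballAvg (fun x => ENNReal.ofReal (nu w x)) c r) ^ m ≤ C * ∏ i, ballEssInf (w i) c r := by
  obtain ⟨hw, C, hC⟩ := hw
  refine ⟨max C 1, le_max_right _ _, fun c r hr => ?_⟩
  have he : ∀ i, ballEssInf (w i) c r ≠ ⊤ := fun i => (hw i).ballEssInf_ne_top c hr
  have h := hC c r hr
  rw [← ENNReal.prod_inv_distrib fun i _ j _ _ => Or.inr (he j), ← div_eq_mul_inv,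
    ENNReal.div_le_iff_le_mul (Or.inr ENNReal.coe_ne_top)
      (Or.inl (ENNReal.prod_ne_top fun i _ => he i))] at h
  refine h.trans ?_
  gcongr
  exact le_max_left _ _

/-- Local integrability of `ν` is not assumed; it follows from the multiple weight condition and the
finiteness of the infima. -/
theorem IsMultiA1.wMeasure_nu_ball_ne_top (hm : m ≠ 0) {w : Fin m → E n → ℝ} (hw : IsMultiA1 w)
    (c : E n) {r : ℝ} (hr : 0 < r) : wMeasure (nu w) (Metric.ball c r) ≠ ⊤ := by
  obtain ⟨C, -, hC⟩ := hw.exists_ballAvg_pow_le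
  have h : (ballAvg (fun x => ENNReal.ofReal (nu w x)) c r) ^ m ≠ ⊤ :=
    ne_top_of_le_ne_top (ENNReal.mul_ne_top ENNReal.coe_ne_top
      (ENNReal.prod_ne_top fun i _ => (hw.1 i).ballEssInf_ne_top c hr)) (hC c r hr)
  rw [wMeasure_ball_eq_volume_mul _ c hr]
  refine ENNReal.mul_ne_top (volume_ball_ne_top c r) fun h' => h ?_
  rw [h', ENNReal.top_pow hm]

theorem wMeasure_nu_ball_ne_zero {w : Fin m → E n → ℝ} (hw : ∀ i, IsWeight (w i))
    (c : E n) {r : ℝ} (hr : 0 < r) : wMeasure (nu w) (Metric.ball c r) ≠ 0 :=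
  wMeasure_ball_ne_zero (nu_ae_pos hw) (aemeasurable_nu hw) c hr

/-- A quantitative form of the `A₁` condition for measures. -/
def BallComparable (μ : Measure (E n)) (C : ℝ≥0) : Prop :=
  ∀ (c : E n) (r : ℝ), 0 < r → ∀ S : Set (E n), MeasurableSet S → S ⊆ Metric.ball c r →
    μ (Metric.ball c r) * volume S ≤ C * volume (Metric.ball c r) * μ S

theorem ballComparable_volume : BallComparable (volume : Measure (E n)) 1 := by
  intro c r _ S _ _
  simp

/-- Almost everywhere on the ball, `(avg ν)^m ≤ C ∏ ess inf w_i ≤ C ∏ w_i(x) = C ν(x)^m`. So `ν`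
satisfies the pointwise `A₁` bound, and integrating it over `S` gives the claim. -/
theorem IsMultiA1.exists_ballComparable (hm : m ≠ 0) {w : Fin m → E n → ℝ} (hw : IsMultiA1 w) :
    ∃ C : ℝ≥0, 1 ≤ C ∧ BallComparable (wMeasure (nu w)) C := by
  obtain ⟨C, hC1, hC⟩ := hw.exists_ballAvg_pow_le
  refine ⟨C, hC1, fun c r hr S hS hSB => ?_⟩
  have key : ∀ᵐ x ∂(volume.restrict (Metric.ball c r)),
      ballAvg (fun x => ENNReal.ofReal (nu w x)) c r ≤ C * ENNReal.ofReal (nu w x) := by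
    have h : ∀ᵐ x ∂(volume.restrict (Metric.ball c r)), ∀ i,
        ballEssInf (w i) c r ≤ ENNReal.ofReal (w i x) :=
      ae_all_iff.mpr fun i => ae_ballEssInf_le (w i) c r
    filter_upwards [h] with x hx
    rw [← ENNReal.pow_le_pow_left_iff hm, mul_pow, ofReal_nu_pow hm fun i => (hw.1 i).nonneg x]
    refine (hC c r hr).trans ?_
    gcongr with i
    · exact_mod_cast le_self_pow₀ hC1 hm
    · exact hx i
  have hν := aemeasurable_nu hw.1
  rw [wMeasure_ball_eq_volume_mul _ c hr, wMeasure_apply hS, mul_assoc, mul_comm (C : ℝ≥0∞),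
    mul_assoc, ← lintegral_const_mul'' _ hν.restrict, ← setLIntegral_const]
  exact mul_le_mul_right (lintegral_mono_ae (ae_restrict_of_ae_restrict_of_subset hSB key)) _

theorem BallComparable.measure_ball_mul_le {μ : Measure (E n)} {C : ℝ≥0} (hμ : BallComparable μ C)
    (c : E n) {r k : ℝ} (hr : 0 < r) (hk : 1 ≤ k) :
    μ (Metric.ball c (k * r)) ≤ C * ENNReal.ofReal (k ^ n) * μ (Metric.ball c r) := by
  have hk0 : 0 < k := by linarith
  have h := hμ c (k * r) (by positivity) (Metric.ball c r) measurableSet_ball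
    (Metric.ball_subset_ball (by nlinarith))
  rw [volume_ball_mul c hk0] at h
  rw [← ENNReal.mul_le_mul_iff_left (volume_ball_ne_zero c hr) (volume_ball_ne_top c r)]
  refine h.trans (le_of_eq ?_)
  ring

/-- In dimension at least one the shell `2B \ B` fills at least half of `2B`. It therefore carries
at least the fraction `(2C)⁻¹` of `μ(2B)`, so doubling the radius gains the factor `1 + (2C)⁻¹`. -/
theorem BallComparable.exists_reverse_doubling (hn : n ≠ 0) {μ : Measure (E n)} {C : ℝ≥0}
    (hμ : BallComparable μ C) (hC : 1 ≤ C) :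
    ∃ γ : ℝ≥0, 1 < γ ∧ ∀ (c : E n) (r : ℝ), 0 < r → ∀ j : ℕ,
      (γ : ℝ≥0∞) ^ j * μ (Metric.ball c r) ≤ μ (Metric.ball c (2 ^ j * r)) := by
  have hC0 : (0 : ℝ≥0) < C := by positivity
  refine ⟨1 + (2 * C)⁻¹, by simp; positivity, ?_⟩
  have step : ∀ (c : E n) (r : ℝ), 0 < r →
      ((1 + (2 * C)⁻¹ : ℝ≥0) : ℝ≥0∞) * μ (Metric.ball c r) ≤ μ (Metric.ball c (2 * r)) := by
    intro c r hr
    set B := Metric.ball c r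
    set B2 := Metric.ball c (2 * r)
    have hsub : B ⊆ B2 := Metric.ball_subset_ball (by linarith)
    have hvol : volume B2 ≤ 2 * volume (B2 \ B) := by
      have h1 : 2 * volume B ≤ volume B2 := by
        rw [volume_ball_mul c two_pos]
        gcongr
        rw [ENNReal.ofReal_pow two_pos.le]
        simpa using le_self_pow₀ (one_le_two (α := ℝ≥0∞)) hn
      have h2 : volume B2 = volume B + volume (B2 \ B) := by
        rw [measure_sdiff hsub measurableSet_ball.nullMeasurableSet (volume_ball_ne_top c r),
          add_tsub_cancel_of_le (measure_mono hsub)]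
      rw [h2, two_mul, ENNReal.add_le_add_iff_left (volume_ball_ne_top c r)] at h1
      rw [h2, two_mul]
      gcongr
    have h3 := hμ c (2 * r) (by positivity) (B2 \ B) (measurableSet_ball.diff measurableSet_ball)
      Set.sdiff_subset
    have h4 : μ B2 ≤ (2 * C : ℝ≥0) * μ (B2 \ B) := by
      rw [← ENNReal.mul_le_mul_iff_left (volume_ball_ne_zero c (by positivity : 0 < 2 * r))
        (volume_ball_ne_top c _)]
      calc μ B2 * volume B2 ≤ μ B2 * (2 * volume (B2 \ B)) := by gcongr
        _ = 2 * (μ B2 * volume (B2 \ B)) := by ring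
        _ ≤ 2 * (C * volume B2 * μ (B2 \ B)) := by gcongr
        _ = _ := by push_cast; ring
    have h5 : (((2 * C)⁻¹ : ℝ≥0) : ℝ≥0∞) * μ B2 ≤ μ (B2 \ B) := by
      have h0 : (2 * C : ℝ≥0) ≠ 0 := by positivity
      rw [ENNReal.coe_inv h0]
      exact ENNReal.inv_mul_le_iff (by exact_mod_cast h0) ENNReal.coe_ne_top |>.mpr h4
    calc ((1 + (2 * C)⁻¹ : ℝ≥0) : ℝ≥0∞) * μ B
        = μ B + ((2 * C)⁻¹ : ℝ≥0) * μ B := by push_cast; ring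
      _ ≤ μ B + ((2 * C)⁻¹ : ℝ≥0) * μ B2 := by gcongr
      _ ≤ μ B + μ (B2 \ B) := by gcongr
      _ = μ B2 := by
        rw [measure_add_sdiff measurableSet_ball.nullMeasurableSet, Set.union_eq_self_of_subset_left hsub]
  intro c r hr j
  induction j with
  | zero => simp
  | succ j ih =>
    calc _ = ((1 + (2 * C)⁻¹ : ℝ≥0) : ℝ≥0∞) *
          (((1 + (2 * C)⁻¹ : ℝ≥0) : ℝ≥0∞) ^ j * μ (Metric.ball c r)) := by ring
      _ ≤ ((1 + (2 * C)⁻¹ : ℝ≥0) : ℝ≥0∞) * μ (Metric.ball c (2 ^ j * r)) := by gcongr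
      _ ≤ μ (Metric.ball c (2 * (2 ^ j * r))) := step c _ (by positivity)
      _ = _ := by rw [pow_succ']; ring_nf

/-! ### Products of `A_∞` weights -/

/-- Since `w⁻¹` is almost everywhere at most the inverse of the essential infimum, the same constant
works. This leaves only exponents `p > 1` to treat in `A_∞`. -/
theorem IsA1.isAp_two {w : E n → ℝ} (hw : IsA1 w) : IsAp 2 w := by
  obtain ⟨hw, C, hC⟩ := hw
  refine ⟨hw, C, fun c r hr => ?_⟩
  have h1 : ballAvg (fun x => ENNReal.ofReal (w x) ^ (-1 / ((2 : ℝ) - 1))) c r ≤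
      (ballEssInf w c r)⁻¹ := by
    rw [ballAvg]
    calc _ ≤ (volume (Metric.ball c r))⁻¹ * ∫⁻ x in Metric.ball c r, (ballEssInf w c r)⁻¹ := by
          refine mul_le_mul_right (lintegral_mono_ae ?_) _
          filter_upwards [ae_ballEssInf_le w c r] with x hx
          norm_num [ENNReal.rpow_neg_one]
          exact hx
      _ = (ballEssInf w c r)⁻¹ := by
        rw [setLIntegral_const, mul_comm, mul_assoc,
          ENNReal.mul_inv_cancel (volume_ball_ne_zero c hr) (volume_ball_ne_top c r), mul_one]
  have h2 : ((2 : ℝ) - 1) = 1 := by norm_num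
  calc _ ≤ C * ballEssInf w c r * (ballEssInf w c r)⁻¹ := by
        gcongr
        · exact hC c r hr
        · rw [h2, ENNReal.rpow_one]
          rwa [h2] at h1
    _ ≤ C * 1 := by
        rw [mul_assoc]
        gcongr
        exact ENNReal.mul_inv_le_one _
    _ = C := mul_one _

theorem IsAInfty.exists_isAp {w : E n → ℝ} (hw : IsAInfty w) : ∃ p : ℝ, 1 < p ∧ IsAp p w := by
  rcases hw with h | h
  · exact ⟨2, one_lt_two, h.isAp_two⟩
  · exact h

/-- Hölder's inequality applied to the identity `1 = ν^s ∏ w_i^{-s/m}`, followed by raising to the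
power `m/s`. -/
theorem one_le_ballAvg_nu_mul (hm : m ≠ 0) {w : Fin m → E n → ℝ} (hw : ∀ i, IsWeight (w i))
    {p : Fin m → ℝ} (hp : ∀ i, 1 < p i) (c : E n) {r : ℝ} (hr : 0 < r) :
    1 ≤ (ballAvg (fun x => ENNReal.ofReal (nu w x)) c r) ^ m *
      ∏ i, (ballAvg (fun x => ENNReal.ofReal (w i x) ^ (-1 / (p i - 1))) c r) ^ (p i - 1) := by
  have hm' : (0 : ℝ) < m := by exact_mod_cast Nat.pos_of_ne_zero hm
  -- Chosen so that the Hölder exponents `s` (for `ν`) and `(p i - 1) s / m` (for the dual weights)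
  -- add up to 1.
  set s : ℝ := (1 + ∑ i, (p i - 1) / m)⁻¹ with hs
  have hsum : 0 ≤ ∑ i, (p i - 1) / m :=
    Finset.sum_nonneg fun i _ => div_nonneg (by linarith [hp i]) hm'.le
  have hs0 : 0 < s := by positivity
  set P := (volume (Metric.ball c r))⁻¹ • volume.restrict (Metric.ball c r) with hP
  let f : Option (Fin m) → E n → ℝ≥0∞ := fun o => o.elim
    (fun x => ENNReal.ofReal (nu w x)) fun i x => ENNReal.ofReal (w i x) ^ (-1 / (p i - 1))
  let q : Option (Fin m) → ℝ := fun o => o.elim s fun i => (p i - 1) / m * s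
  have hac : P ≪ volume :=
    (Measure.AbsolutelyContinuous.smul_left Measure.restrict_le_self.absolutelyContinuous _)
  have hf : ∀ o ∈ (Finset.univ : Finset (Option (Fin m))), AEMeasurable (f o) P := by
    intro o _
    cases o with
    | none => exact (aemeasurable_nu hw).mono_ac hac
    | some i => exact ((hw i).aemeasurable.pow_const _).mono_ac hac
  have hq1 : ∑ o, q o = 1 := by
    rw [Fintype.sum_option]
    change s + ∑ i, (p i - 1) / m * s = 1
    rw [← Finset.sum_mul, ← one_add_mul, hs]
    exact mul_inv_cancel₀ (by positivity)
  have hq0 : ∀ o ∈ (Finset.univ : Finset (Option (Fin m))), 0 ≤ q o := by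
    intro o _
    cases o with
    | none => exact hs0.le
    | some i => exact mul_nonneg (div_nonneg (by linarith [hp i]) hm'.le) hs0.le
  have hH := ENNReal.lintegral_prod_norm_pow_le Finset.univ hf hq1 hq0
  have hone : ∫⁻ x, ∏ o, f o x ^ q o ∂P = 1 := by
    have hpos : ∀ᵐ x ∂P, ∀ i, 0 < w i x := hac.ae_le (ae_all_iff.mpr fun i => (hw i).ae_pos)
    have : ∀ᵐ x ∂P, ∏ o, f o x ^ q o = 1 := by
      filter_upwards [hpos] with x hx
      rw [Fintype.prod_option]
      change ENNReal.ofReal (nu w x) ^ s *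
        ∏ i, (ENNReal.ofReal (w i x) ^ (-1 / (p i - 1))) ^ ((p i - 1) / m * s) = 1
      rw [ofReal_nu fun i => (hx i).le, ← ENNReal.prod_rpow_of_nonneg hs0.le,
        ← Finset.prod_mul_distrib]
      refine Finset.prod_eq_one fun i _ => ?_
      have hi : p i - 1 ≠ 0 := by linarith [hp i]
      rw [← ENNReal.rpow_mul, ← ENNReal.rpow_mul, ← ENNReal.rpow_add _ _
        (by simpa using hx i) ENNReal.ofReal_ne_top]
      have : 1 / (m : ℝ) * s + -1 / (p i - 1) * ((p i - 1) / m * s) = 0 := by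
        field_simp
        ring
      rw [this, ENNReal.rpow_zero]
    rw [lintegral_congr_ae this, lintegral_one, hP, Measure.smul_apply,
      Measure.restrict_apply_univ, smul_eq_mul,
      ENNReal.inv_mul_cancel (volume_ball_ne_zero c hr) (volume_ball_ne_top c r)]
  rw [hone, Fintype.prod_option] at hH
  have h2 := ENNReal.rpow_le_rpow hH (by positivity : 0 ≤ (m : ℝ) / s)
  rw [ENNReal.one_rpow, ENNReal.mul_rpow_of_nonneg _ _ (by positivity),
    ← ENNReal.prod_rpow_of_nonneg (by positivity), ← ENNReal.rpow_mul] at h2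
  refine h2.trans (le_of_eq ?_)
  congr 1
  · change (∫⁻ x, ENNReal.ofReal (nu w x) ∂P) ^ (s * (m / s)) = _
    rw [ballAvg_eq_lintegral, mul_div_cancel₀ _ hs0.ne', ENNReal.rpow_natCast]
  · refine Finset.prod_congr rfl fun i _ => ?_
    change ((∫⁻ x, ENNReal.ofReal (w i x) ^ (-1 / (p i - 1)) ∂P) ^ ((p i - 1) / m * s)) ^
      (m / s) = _
    rw [ballAvg_eq_lintegral, ← ENNReal.rpow_mul]
    congr 1
    field_simp

/-- Multiplying the product of the averages of the `w i` by the preceding lower bound makes each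
`A_p` expression appear, so only `(avg ν)^m` remains. -/
theorem exists_prod_wMeasure_ball_le (hm : m ≠ 0) {w : Fin m → E n → ℝ}
    (hw : ∀ i, IsWeight (w i)) (hw' : ∀ i, IsAInfty (w i)) :
    ∃ C : ℝ≥0, ∀ (c : E n) (r : ℝ), 0 < r →
      ∏ i, wMeasure (w i) (Metric.ball c r) ≤ C * wMeasure (nu w) (Metric.ball c r) ^ m := by
  choose p hp hAp using fun i => (hw' i).exists_isAp
  choose C hC using fun i => (hAp i).2
  refine ⟨∏ i, C i, fun c r hr => ?_⟩
  have h1 := one_le_ballAvg_nu_mul hm hw hp c hr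
  have h2 : ∏ i, ballAvg (fun x => ENNReal.ofReal (w i x)) c r ≤
      (∏ i, (C i : ℝ≥0∞)) * (ballAvg (fun x => ENNReal.ofReal (nu w x)) c r) ^ m := by
    calc ∏ i, ballAvg (fun x => ENNReal.ofReal (w i x)) c r
        ≤ (∏ i, ballAvg (fun x => ENNReal.ofReal (w i x)) c r) *
          ((ballAvg (fun x => ENNReal.ofReal (nu w x)) c r) ^ m *
            ∏ i, (ballAvg (fun x => ENNReal.ofReal (w i x) ^ (-1 / (p i - 1))) c r) ^ (p i - 1)) :=
          le_mul_of_one_le_right zero_le h1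
      _ = (∏ i, ballAvg (fun x => ENNReal.ofReal (w i x)) c r *
            (ballAvg (fun x => ENNReal.ofReal (w i x) ^ (-1 / (p i - 1))) c r) ^ (p i - 1)) *
          (ballAvg (fun x => ENNReal.ofReal (nu w x)) c r) ^ m := by
          rw [Finset.prod_mul_distrib]; ring
      _ ≤ _ := by
          gcongr with i
          exact hC i c r hr
  simp_rw [wMeasure_ball_eq_volume_mul _ c hr, Finset.prod_mul_distrib, mul_pow]
  rw [Finset.prod_const, Finset.card_univ, Fintype.card_fin, ENNReal.ofNNReal_finsetProd,
    mul_left_comm]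
  gcongr

end Weights

end MorreyLLogL

namespace MorreyLLogL

/-! ### Averages over sets and mean oscillation. -/

section Averages

variable {n : ℕ}

/-- The average of a nonnegative function over a set. -/
noncomputable def setAvg (S : Set (E n)) (g : E n → ℝ≥0∞) : ℝ≥0∞ :=
  (volume S)⁻¹ * ∫⁻ x in S, g x

theorem setAvg_const {S : Set (E n)} (h0 : volume S ≠ 0) (ht : volume S ≠ ⊤) (a : ℝ≥0∞) :
    setAvg S (fun _ => a) = a := by
  rw [setAvg, setLIntegral_const, mul_left_comm, ENNReal.inv_mul_cancel h0 ht, mul_one]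

theorem setAvg_mono {S : Set (E n)} {g h : E n → ℝ≥0∞} (hgh : ∀ x, g x ≤ h x) :
    setAvg S g ≤ setAvg S h :=
  mul_le_mul_right (lintegral_mono hgh) _

theorem volume_mul_setAvg {S : Set (E n)} (h0 : volume S ≠ 0) (ht : volume S ≠ ⊤)
    (g : E n → ℝ≥0∞) : volume S * setAvg S g = ∫⁻ x in S, g x := by
  rw [setAvg, ← mul_assoc, ENNReal.mul_inv_cancel h0 ht, one_mul]

theorem setAvg_le_mul_setAvg {S T : Set (E n)} (hST : S ⊆ T) {K : ℝ≥0∞}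
    (hK : volume T ≤ K * volume S) (h0 : volume S ≠ 0) (ht : volume T ≠ ⊤) (g : E n → ℝ≥0∞) :
    setAvg S g ≤ K * setAvg T g := by
  have hT0 : volume T ≠ 0 := fun h => h0 (measure_mono_null hST h)
  have hSt : volume S ≠ ⊤ := ne_top_of_le_ne_top ht (measure_mono hST)
  rw [setAvg, ENNReal.inv_mul_le_iff h0 hSt]
  calc ∫⁻ x in S, g x ≤ ∫⁻ x in T, g x := lintegral_mono_set hST
    _ = volume T * setAvg T g := (volume_mul_setAvg hT0 ht g).symm
    _ ≤ K * volume S * setAvg T g := by gcongr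
    _ = _ := by ring

theorem enorm_average_sub_le {S : Set (E n)} (h0 : volume S ≠ 0) (ht : volume S ≠ ⊤)
    {b : E n → ℂ} (hb : IntegrableOn b S) (β : ℂ) :
    ‖(⨍ y in S, b y) - β‖ₑ ≤ setAvg S fun x => ‖b x - β‖ₑ := by
  have hP : IsProbabilityMeasure ((volume S)⁻¹ • (volume : Measure (E n)).restrict S) :=
    ⟨by rw [Measure.smul_apply, Measure.restrict_apply_univ, smul_eq_mul,
      ENNReal.inv_mul_cancel h0 ht]⟩
  have hb' : Integrable b ((volume S)⁻¹ • (volume : Measure (E n)).restrict S) :=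
    Integrable.smul_measure hb (ENNReal.inv_ne_top.mpr h0)
  have h1 : (⨍ y in S, b y) - β =
      ∫ y, (b y - β) ∂((volume S)⁻¹ • (volume : Measure (E n)).restrict S) := by
    rw [integral_sub hb' (integrable_const _), average, Measure.restrict_apply_univ]
    simp
  rw [h1]
  refine (enorm_integral_le_lintegral_enorm _).trans (le_of_eq ?_)
  rw [lintegral_smul_measure, setAvg, smul_eq_mul]

/-- Replacing an arbitrary constant by the average costs a factor 2, and enlarging the set costs the
volume ratio. -/
theorem setAvg_sub_average_le {S T : Set (E n)} (hST : S ⊆ T) {K : ℝ≥0∞}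
    (hK : volume T ≤ K * volume S) (h0 : volume S ≠ 0) (ht : volume T ≠ ⊤)
    {b : E n → ℂ} (hb : IntegrableOn b S) (β : ℂ) :
    setAvg S (fun x => ‖b x - ⨍ y in S, b y‖ₑ) ≤ 2 * K * setAvg T fun x => ‖b x - β‖ₑ := by
  have hSt : volume S ≠ ⊤ := ne_top_of_le_ne_top ht (measure_mono hST)
  have h1 := setAvg_le_mul_setAvg hST hK h0 ht fun x => ‖b x - β‖ₑ
  have h2 := enorm_average_sub_le h0 hSt hb β
  calc setAvg S (fun x => ‖b x - ⨍ y in S, b y‖ₑ)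
      ≤ setAvg S fun x => ‖b x - β‖ₑ + ‖(⨍ y in S, b y) - β‖ₑ := by
        refine setAvg_mono fun x => ?_
        have : b x - (⨍ y in S, b y) = (b x - β) - ((⨍ y in S, b y) - β) := by ring
        rw [this]
        exact enorm_sub_le
    _ = setAvg S (fun x => ‖b x - β‖ₑ) + ‖(⨍ y in S, b y) - β‖ₑ := by
        simp only [setAvg]
        rw [lintegral_add_right _ measurable_const, mul_add]
        congr 1
        exact setAvg_const h0 hSt _
    _ ≤ setAvg S (fun x => ‖b x - β‖ₑ) + setAvg S (fun x => ‖b x - β‖ₑ) := by gcongr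
    _ = 2 * setAvg S (fun x => ‖b x - β‖ₑ) := (two_mul _).symm
    _ ≤ _ := by rw [mul_assoc]; gcongr

theorem ballAvg_sub_average_le_bmoNorm (b : E n → ℂ) (c : E n) {r : ℝ} (hr : 0 < r) :
    setAvg (Metric.ball c r) (fun x => ‖b x - ⨍ y in Metric.ball c r, b y‖ₑ) ≤ bmoNorm b := by
  unfold bmoNorm
  exact le_iSup_of_le c (le_iSup_of_le r (le_iSup_of_le hr le_rfl))

end Averages

/-! ### Dyadic cubes, their comparison with balls, and differentiation along them. -/

section Grid

variable {n : ℕ}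

/-- The index of the dyadic cube of side `s / 2 ^ k` that contains `x`. -/
noncomputable def gridIndex (c : E n) (s : ℝ) (k : ℕ) (x : E n) : Fin n → ℤ :=
  fun i => ⌊(x i - c i) / s * 2 ^ k⌋

/-- The half-open dyadic cubes of side `s / 2 ^ k`. -/
def gridCube (c : E n) (s : ℝ) (k : ℕ) (z : Fin n → ℤ) : Set (E n) := gridIndex c s k ⁻¹' {z}

theorem measurable_gridIndex (c : E n) (s : ℝ) (k : ℕ) : Measurable (gridIndex c s k) := by
  refine measurable_pi_lambda _ fun i => Int.measurable_floor.comp ?_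
  fun_prop

theorem measurableSet_gridCube (c : E n) (s : ℝ) (k : ℕ) (z : Fin n → ℤ) :
    MeasurableSet (gridCube c s k z) :=
  measurable_gridIndex c s k (measurableSet_singleton z)

theorem mem_gridCube_gridIndex (c : E n) (s : ℝ) (k : ℕ) (x : E n) :
    x ∈ gridCube c s k (gridIndex c s k x) := rfl

theorem gridIndex_eq_div_two (c : E n) (s : ℝ) (k : ℕ) (x : E n) :
    gridIndex c s k x = fun i => gridIndex c s (k + 1) x i / 2 := by
  funext i
  simp only [gridIndex]
  have h := Int.floor_div_natCast ((x i - c i) / s * 2 ^ (k + 1)) 2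
  push_cast at h
  rw [← h]
  congr 1
  ring

/-- Halving the index with integer division leads from a cube to its parent, so the children of `z`
are the indices that halve to `z`. -/
theorem gridCube_eq_iUnion (c : E n) (s : ℝ) (k : ℕ) (z : Fin n → ℤ) :
    gridCube c s k z =
      ⋃ z' : {z' : Fin n → ℤ // (fun i => z' i / 2) = z}, gridCube c s (k + 1) z' := by
  ext x
  simp only [gridCube, Set.mem_preimage, Set.mem_singleton_iff, Set.mem_iUnion]
  rw [gridIndex_eq_div_two]
  constructor
  · intro h
    exact ⟨⟨_, h⟩, rfl⟩
  · rintro ⟨z', h⟩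
    rw [h]
    exact z'.2

theorem disjoint_gridCube (c : E n) (s : ℝ) (k : ℕ) {z z' : Fin n → ℤ} (h : z ≠ z') :
    Disjoint (gridCube c s k z) (gridCube c s k z') :=
  Disjoint.preimage _ (Set.disjoint_singleton.mpr h)

theorem mem_gridCube_iff (c : E n) {s : ℝ} (hs : 0 < s) (k : ℕ) (z : Fin n → ℤ) (x : E n) :
    x ∈ gridCube c s k z ↔
      ∀ i, x i ∈ Set.Ico (c i + z i * (s / 2 ^ k)) (c i + (z i + 1) * (s / 2 ^ k)) := by
  simp only [gridCube, Set.mem_preimage, Set.mem_singleton_iff, funext_iff, gridIndex,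
    Int.floor_eq_iff, Set.mem_Ico]
  refine forall_congr' fun i => ?_
  have h2 : (0 : ℝ) < s / 2 ^ k := by positivity
  have h3 : (x i - c i) / s * 2 ^ k = (x i - c i) / (s / 2 ^ k) := by field_simp
  rw [h3, le_div_iff₀ h2, div_lt_iff₀ h2]
  constructor <;> rintro ⟨h, h'⟩ <;> constructor <;> linarith

theorem volume_gridCube (c : E n) {s : ℝ} (hs : 0 < s) (k : ℕ) (z : Fin n → ℤ) :
    volume (gridCube c s k z) = ENNReal.ofReal ((s / 2 ^ k) ^ n) := by
  have h : gridCube c s k z = (MeasurableEquiv.toLp 2 (Fin n → ℝ)).symm ⁻¹'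
      (Set.univ.pi fun i =>
        Set.Ico (c i + z i * (s / 2 ^ k)) (c i + (z i + 1) * (s / 2 ^ k))) := by
    ext x
    rw [mem_gridCube_iff c hs, Set.mem_preimage, Set.mem_univ_pi]
    rfl
  rw [h, (EuclideanSpace.volume_preserving_symm_measurableEquiv_toLp _).measure_preimage
    (MeasurableSet.univ_pi fun i => measurableSet_Ico).nullMeasurableSet, Real.volume_pi_Ico]
  have : ∀ i, c i + (z i + 1) * (s / 2 ^ k) - (c i + z i * (s / 2 ^ k)) = s / 2 ^ k :=
    fun i => by ring
  simp_rw [this]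
  rw [Finset.prod_const, Finset.card_univ, Fintype.card_fin, ENNReal.ofReal_pow (by positivity)]

theorem volume_gridCube_ne_zero (c : E n) {s : ℝ} (hs : 0 < s) (k : ℕ) (z : Fin n → ℤ) :
    volume (gridCube c s k z) ≠ 0 := by
  rw [volume_gridCube c hs, ne_eq, ENNReal.ofReal_eq_zero, not_le]
  positivity

theorem volume_gridCube_ne_top (c : E n) {s : ℝ} (hs : 0 < s) (k : ℕ) (z : Fin n → ℤ) :
    volume (gridCube c s k z) ≠ ⊤ := by
  rw [volume_gridCube c hs]
  exact ENNReal.ofReal_ne_top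

theorem volume_gridCube_eq_two_pow_mul (c : E n) {s : ℝ} (hs : 0 < s) (k : ℕ)
    (z z' : Fin n → ℤ) :
    volume (gridCube c s k z) = 2 ^ n * volume (gridCube c s (k + 1) z') := by
  rw [volume_gridCube c hs, volume_gridCube c hs]
  have : (2 : ℝ≥0∞) = ENNReal.ofReal 2 := by simp
  rw [this, ← ENNReal.ofReal_pow two_pos.le, ← ENNReal.ofReal_mul (by positivity), ← mul_pow]
  congr 2
  rw [pow_succ]
  field_simp

theorem dist_le_of_forall_abs_sub_le {x y : E n} {d : ℝ} (hd : 0 ≤ d)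
    (h : ∀ i, |x i - y i| ≤ d) : dist x y ≤ n * d := by
  rw [EuclideanSpace.dist_eq, Real.sqrt_le_iff]
  refine ⟨by positivity, ?_⟩
  calc ∑ i, dist (x i) (y i) ^ 2 ≤ ∑ _i : Fin n, d ^ 2 := by
        gcongr with i
        exact h i
    _ = n * d ^ 2 := by simp
    _ ≤ (n * d) ^ 2 := by
      rw [mul_pow]
      gcongr
      exact_mod_cast Nat.le_self_pow two_ne_zero n

theorem dist_le_of_mem_gridCube {c : E n} {s : ℝ} (hs : 0 < s) {k : ℕ} {z : Fin n → ℤ}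
    {x y : E n} (hx : x ∈ gridCube c s k z) (hy : y ∈ gridCube c s k z) :
    dist x y ≤ n * (s / 2 ^ k) := by
  rw [mem_gridCube_iff c hs] at hx hy
  refine dist_le_of_forall_abs_sub_le (by positivity) fun i => ?_
  obtain ⟨h1, h2⟩ := hx i
  obtain ⟨h3, h4⟩ := hy i
  rw [abs_le]
  constructor <;> linarith

theorem gridCube_subset_ball {c : E n} {s : ℝ} (hs : 0 < s) {k : ℕ} {z : Fin n → ℤ}
    {x : E n} (hx : x ∈ gridCube c s k z) :
    gridCube c s k z ⊆ Metric.ball x ((n + 1) * (s / 2 ^ k)) := by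
  intro y hy
  have h := dist_le_of_mem_gridCube hs hy hx
  have : 0 < s / 2 ^ k := by positivity
  rw [Metric.mem_ball]
  linarith

/-- The ratio of the volumes of a ball of radius `(n + 1) s` and of a cube of side `s`. -/
noncomputable def ballCubeRatio (n : ℕ) : ℝ≥0 :=
  (ENNReal.ofReal ((n + 1 : ℝ) ^ n) * volume (Metric.ball (0 : E n) 1)).toNNReal

theorem volume_ball_eq_ballCubeRatio_mul (c : E n) {s : ℝ} (hs : 0 < s) (k : ℕ) (z : Fin n → ℤ)
    (x : E n) : volume (Metric.ball x ((n + 1) * (s / 2 ^ k))) =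
      ballCubeRatio n * volume (gridCube c s k z) := by
  rw [ballCubeRatio, ENNReal.coe_toNNReal
    (ENNReal.mul_ne_top ENNReal.ofReal_ne_top (volume_ball_ne_top _ _)),
    Measure.addHaar_ball_of_pos _ _ (by positivity), volume_gridCube c hs, mul_right_comm,
    ← ENNReal.ofReal_mul (by positivity), ← mul_pow]
  simp

theorem exists_mem_gridCube (c : E n) {s : ℝ} (hs : 0 < s) (k : ℕ) (z : Fin n → ℤ) :
    ∃ x, x ∈ gridCube c s k z :=
  nonempty_of_measure_ne_zero (volume_gridCube_ne_zero c hs k z)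

/-- The BMO norm is defined with balls; each cube sits in a ball of comparable volume, which
transfers the oscillation bound to cubes. -/
theorem setAvg_gridCube_le {b : E n → ℂ} (hb : LocallyIntegrable b volume) (c : E n) {s : ℝ}
    (hs : 0 < s) (k : ℕ) (z : Fin n → ℤ) :
    setAvg (gridCube c s k z) (fun x => ‖b x - ⨍ y in gridCube c s k z, b y‖ₑ) ≤
      2 * ballCubeRatio n * bmoNorm b := by
  obtain ⟨x, hx⟩ := exists_mem_gridCube c hs k z
  have hsub := gridCube_subset_ball hs hx
  have hint : IntegrableOn b (gridCube c s k z) :=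
    (hb.integrableOn_isCompact (isCompact_closedBall x ((n + 1) * (s / 2 ^ k)))).mono_set
      (hsub.trans Metric.ball_subset_closedBall)
  refine (setAvg_sub_average_le hsub (volume_ball_eq_ballCubeRatio_mul c hs k z x).le
    (volume_gridCube_ne_zero c hs k z) (volume_ball_ne_top _ _) hint
    (⨍ y in Metric.ball x ((n + 1) * (s / 2 ^ k)), b y)).trans ?_
  gcongr
  exact ballAvg_sub_average_le_bmoNorm b x (by positivity)

/-- The average of `b` over a dyadic cube. -/
noncomputable def cubeMean (b : E n → ℂ) (c : E n) (s : ℝ) (k : ℕ) (z : Fin n → ℤ) : ℂ :=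
  ⨍ y in gridCube c s k z, b y

theorem LocallyIntegrable.integrableOn_gridCube {b : E n → ℂ} (hb : LocallyIntegrable b volume)
    (c : E n) {s : ℝ} (hs : 0 < s) (k : ℕ) (z : Fin n → ℤ) :
    IntegrableOn b (gridCube c s k z) := by
  obtain ⟨x, hx⟩ := exists_mem_gridCube c hs k z
  exact (hb.integrableOn_isCompact (isCompact_closedBall x ((n + 1) * (s / 2 ^ k)))).mono_set
    ((gridCube_subset_ball hs hx).trans Metric.ball_subset_closedBall)

/-- The cubes containing `x` shrink regularly: each lies in a ball around `x` of comparable volume.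
Convergence thus holds at Lebesgue points. -/
theorem ae_tendsto_cubeMean {b : E n → ℂ} (hb : LocallyIntegrable b volume) (c : E n) {s : ℝ}
    (hs : 0 < s) :
    ∀ᵐ x, Filter.Tendsto (fun k => cubeMean b c s k (gridIndex c s k x)) Filter.atTop
      (nhds (b x)) := by
  filter_upwards [IsUnifLocDoublingMeasure.ae_tendsto_average_norm_sub volume hb 1] with x hx
  have hlim : Filter.Tendsto (fun k : ℕ => (n + 1 : ℝ) * (s / 2 ^ k)) Filter.atTop
      (nhdsWithin 0 (Set.Ioi 0)) := by
    refine tendsto_nhdsWithin_iff.mpr ⟨?_, Filter.Eventually.of_forall fun k => ?_⟩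
    · have h := (tendsto_pow_atTop_nhds_zero_of_lt_one (r := (1 / 2 : ℝ)) (by norm_num)
        (by norm_num)).const_mul ((n + 1 : ℝ) * s)
      rw [mul_zero] at h
      refine h.congr fun k => ?_
      rw [one_div, inv_pow]
      field_simp
    · change (0 : ℝ) < _
      positivity
  have h := hx (fun _ => x) (fun k : ℕ => (n + 1 : ℝ) * (s / 2 ^ k)) hlim
    (Filter.Eventually.of_forall fun k => by
      rw [one_mul]
      exact Metric.mem_closedBall_self (by positivity))
  rw [tendsto_iff_enorm_sub_tendsto_zero]
  have h2 : Filter.Tendsto (fun k : ℕ => (ballCubeRatio n : ℝ≥0∞) * ENNReal.ofReal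
      (⨍ y in Metric.closedBall x ((n + 1 : ℝ) * (s / 2 ^ k)), ‖b y - b x‖))
      Filter.atTop (nhds 0) := by
    have := ENNReal.Tendsto.const_mul (ENNReal.tendsto_ofReal h)
      (Or.inr (ENNReal.coe_ne_top (r := ballCubeRatio n)))
    simpa using this
  refine tendsto_of_tendsto_of_tendsto_of_le_of_le tendsto_const_nhds h2 (fun _ => zero_le)
    fun k => ?_
  have hr : 0 < (n + 1 : ℝ) * (s / 2 ^ k) := by positivity
  -- Differentiation is along closed balls and the volume comparison along open ones; they differ by
  -- a null set.
  have hB : Metric.closedBall x ((n + 1 : ℝ) * (s / 2 ^ k)) =ᵐ[volume]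
      Metric.ball x ((n + 1 : ℝ) * (s / 2 ^ k)) :=
    (ae_eq_of_subset_of_measure_ge Metric.ball_subset_closedBall
      (by rw [Measure.addHaar_closedBall _ _ hr.le, Measure.addHaar_ball_of_pos _ _ hr])
      measurableSet_ball.nullMeasurableSet (measure_closedBall_lt_top.ne)).symm
  have hsub := gridCube_subset_ball hs (mem_gridCube_gridIndex c s k x)
  refine (enorm_average_sub_le (volume_gridCube_ne_zero c hs k _)
    (volume_gridCube_ne_top c hs k _) (LocallyIntegrable.integrableOn_gridCube hb c hs k _)
    (b x)).trans ?_
  refine (setAvg_le_mul_setAvg hsub (volume_ball_eq_ballCubeRatio_mul c hs k _ x).le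
    (volume_gridCube_ne_zero c hs k _) (volume_ball_ne_top _ _) _).trans ?_
  gcongr
  rw [setAverage_congr hB]
  have hint : IntegrableOn (fun y => b y - b x) (Metric.ball x ((n + 1 : ℝ) * (s / 2 ^ k))) :=
    ((hb.integrableOn_isCompact (isCompact_closedBall x _)).mono_set
      Metric.ball_subset_closedBall).sub (integrableOn_const (volume_ball_ne_top _ _))
  rw [setAverage_eq, smul_eq_mul, ENNReal.ofReal_mul (by positivity),
    ofReal_integral_norm_eq_lintegral_enorm hint, setAvg, measureReal_def, ← ENNReal.toReal_inv,
    ENNReal.ofReal_toReal (ENNReal.inv_ne_top.mpr (volume_ball_ne_zero x hr))]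

end Grid

end MorreyLLogL

namespace MorreyLLogL

/-! ### John-Nirenberg inequality for measures of class `A₁`. -/

section JohnNirenberg

variable {n : ℕ}

/-- The exponential `exp (a |z|)`, with values in `[0, ∞]`. -/
noncomputable def expNorm (a : ℝ) (z : ℂ) : ℝ≥0∞ := ENNReal.ofReal (Real.exp (a * ‖z‖))

theorem continuous_expNorm (a : ℝ) : Continuous (expNorm a) := by
  unfold expNorm
  exact ENNReal.continuous_ofReal.comp (by fun_prop)

theorem expNorm_sub_le {a : ℝ} (ha : 0 ≤ a) {x y β : ℂ} {d : ℝ≥0} (h : ‖y - β‖ₑ ≤ d) :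
    expNorm a (x - β) ≤ ENNReal.ofReal (Real.exp (a * d)) * expNorm a (x - y) := by
  rw [expNorm, expNorm, ← ENNReal.ofReal_mul (Real.exp_pos _).le, ← Real.exp_add, ← mul_add]
  have h1 : ‖y - β‖ ≤ d := by
    rw [enorm_le_coe] at h
    exact_mod_cast h
  have h2 := norm_sub_le_norm_sub_add_norm_sub x y β
  gcongr
  linarith

theorem lintegral_gridCube_eq_tsum (μ : Measure (E n)) (c : E n) (s : ℝ) (k : ℕ)
    (z : Fin n → ℤ) (g : E n → ℝ≥0∞) :
    ∫⁻ x in gridCube c s k z, g x ∂μ =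
      ∑' z' : {z' : Fin n → ℤ // (fun i => z' i / 2) = z},
        ∫⁻ x in gridCube c s (k + 1) z', g x ∂μ := by
  rw [gridCube_eq_iUnion]
  exact lintegral_iUnion (β := {z' : Fin n → ℤ // (fun i => z' i / 2) = z})
    (s := fun z' => gridCube c s (k + 1) z') (fun z' => measurableSet_gridCube c s (k + 1) z')
    (fun _ _ h => disjoint_gridCube c s (k + 1) fun h' => h (Subtype.ext h')) g

/-- One step of the Calderón-Zygmund stopping argument: the exponential integral of the
approximations of `b` on a cube is controlled by its measure and by that of the union `S` of the
stopped cubes. -/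
theorem exists_stopping_set {μ : Measure (E n)} {b : E n → ℂ} (hb : LocallyIntegrable b volume)
    (c : E n) {s : ℝ} (hs : 0 < s) {a : ℝ} (ha : 0 ≤ a) (L : ℝ≥0) (Λ : ℝ≥0∞) (K : ℕ)
    (hP : ∀ j < K, ∀ k z, ∫⁻ x in gridCube c s k z,
      expNorm a (cubeMean b c s (k + j) (gridIndex c s (k + j) x) - cubeMean b c s k z) ∂μ ≤
        Λ * μ (gridCube c s k z)) :
    ∀ j ≤ K, ∀ k z (β : ℂ), setAvg (gridCube c s k z) (fun x => ‖b x - β‖ₑ) ≤ L →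
      ∃ S ⊆ gridCube c s k z, MeasurableSet S ∧
        L * volume S ≤ ∫⁻ x in S, ‖b x - β‖ₑ ∧
        ∫⁻ x in gridCube c s k z,
          expNorm a (cubeMean b c s (k + j) (gridIndex c s (k + j) x) - β) ∂μ ≤
        ENNReal.ofReal (Real.exp (a * L)) * μ (gridCube c s k z) +
          ENNReal.ofReal (Real.exp (a * (2 ^ n * L : ℝ≥0))) * Λ * μ S := by
  intro j
  induction j with
  | zero =>
    intro _ k z β hβ
    refine ⟨∅, Set.empty_subset _, MeasurableSet.empty, by simp, ?_⟩
    have h1 : ‖cubeMean b c s k z - β‖ₑ ≤ L :=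
      (enorm_average_sub_le (volume_gridCube_ne_zero c hs k z) (volume_gridCube_ne_top c hs k z)
        (LocallyIntegrable.integrableOn_gridCube hb c hs k z) β).trans hβ
    have h2 : ∀ x ∈ gridCube c s k z,
        expNorm a (cubeMean b c s (k + 0) (gridIndex c s (k + 0) x) - β) ≤
          ENNReal.ofReal (Real.exp (a * L)) := by
      intro x hx
      have hx' : gridIndex c s (k + 0) x = z := hx
      rw [hx']
      have := expNorm_sub_le ha (x := cubeMean b c s k z) h1
      simpa [expNorm] using this
    calc _ ≤ ∫⁻ x in gridCube c s k z, ENNReal.ofReal (Real.exp (a * L)) ∂μ :=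
          setLIntegral_mono measurable_const h2
      _ ≤ _ := by rw [setLIntegral_const]; exact le_self_add
  | succ j ih =>
    intro hj k z β hβ
    have child : ∀ z' : {z' : Fin n → ℤ // (fun i => z' i / 2) = z},
        ∃ S ⊆ gridCube c s (k + 1) z', MeasurableSet S ∧
          L * volume S ≤ ∫⁻ x in S, ‖b x - β‖ₑ ∧
          ∫⁻ x in gridCube c s (k + 1) z',
            expNorm a (cubeMean b c s (k + 1 + j) (gridIndex c s (k + 1 + j) x) - β) ∂μ ≤
          ENNReal.ofReal (Real.exp (a * L)) * μ (gridCube c s (k + 1) z') +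
            ENNReal.ofReal (Real.exp (a * (2 ^ n * L : ℝ≥0))) * Λ * μ S := by
      intro z'
      have h0 := volume_gridCube_ne_zero c hs (k + 1) z'
      have ht := volume_gridCube_ne_top c hs (k + 1) z'
      -- A child whose oscillation about `β` is still at most `L` is passed to the induction with
      -- the same `β`. Otherwise it is stopped and becomes part of `S` in full.
      by_cases hz : setAvg (gridCube c s (k + 1) z') (fun x => ‖b x - β‖ₑ) ≤ L
      · exact ih (by omega) (k + 1) z' β hz
      · refine ⟨gridCube c s (k + 1) z', subset_rfl, measurableSet_gridCube c s (k + 1) z', ?_, ?_⟩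
        · rw [← volume_mul_setAvg h0 ht, mul_comm]
          gcongr
          exact (not_le.mp hz).le
        · have hsub : gridCube c s (k + 1) z' ⊆ gridCube c s k z := by
            rw [gridCube_eq_iUnion c s k z]
            exact Set.subset_iUnion
              (fun z' : {z' : Fin n → ℤ // (fun i => z' i / 2) = z} => gridCube c s (k + 1) z') z'
          -- The parent was not stopped, so the average over the child exceeds `L` by a factor of at
          -- most `2 ^ n`, the volume ratio. The exponential is then recentred at the mean of the
          -- child, where `hP` applies.
          have h1 : ‖cubeMean b c s (k + 1) z' - β‖ₑ ≤ (2 ^ n * L : ℝ≥0) := by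
            refine (enorm_average_sub_le h0 ht
              (LocallyIntegrable.integrableOn_gridCube hb c hs (k + 1) z') β).trans ?_
            refine (setAvg_le_mul_setAvg hsub
              (volume_gridCube_eq_two_pow_mul c hs k z z').le h0
              (volume_gridCube_ne_top c hs k z) _).trans ?_
            push_cast
            gcongr
          calc _ ≤ ∫⁻ x in gridCube c s (k + 1) z',
                ENNReal.ofReal (Real.exp (a * (2 ^ n * L : ℝ≥0))) *
                expNorm a (cubeMean b c s (k + 1 + j) (gridIndex c s (k + 1 + j) x) -
                  cubeMean b c s (k + 1) z') ∂μ := lintegral_mono fun x => expNorm_sub_le ha h1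
            _ = ENNReal.ofReal (Real.exp (a * (2 ^ n * L : ℝ≥0))) *
                ∫⁻ x in gridCube c s (k + 1) z',
                expNorm a (cubeMean b c s (k + 1 + j) (gridIndex c s (k + 1 + j) x) -
                  cubeMean b c s (k + 1) z') ∂μ :=
                lintegral_const_mul' _ _ ENNReal.ofReal_ne_top
            _ ≤ ENNReal.ofReal (Real.exp (a * (2 ^ n * L : ℝ≥0))) *
                (Λ * μ (gridCube c s (k + 1) z')) := by
              gcongr
              exact hP j (by omega) (k + 1) z'
            _ ≤ _ := by rw [← mul_assoc]; exact le_add_self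
    choose S hSsub hSm hSL hSint using child
    have hdisj : Pairwise (Function.onFun Disjoint S) := fun z₁ z₂ h =>
      (disjoint_gridCube c s (k + 1) fun h' => h (Subtype.ext h')).mono (hSsub z₁) (hSsub z₂)
    refine ⟨⋃ z', S z', ?_, MeasurableSet.iUnion hSm, ?_, ?_⟩
    · rw [gridCube_eq_iUnion c s k z]
      exact Set.iUnion_mono hSsub
    · rw [measure_iUnion hdisj hSm, lintegral_iUnion hSm hdisj, ← ENNReal.tsum_mul_left]
      exact ENNReal.tsum_le_tsum hSL
    · have hk : k + (j + 1) = k + 1 + j := by omega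
      rw [hk, lintegral_gridCube_eq_tsum, measure_iUnion hdisj hSm,
        ← setLIntegral_one (gridCube c s k z), lintegral_gridCube_eq_tsum,
        ← ENNReal.tsum_mul_left, ← ENNReal.tsum_mul_left, ← ENNReal.tsum_add]
      refine ENNReal.tsum_le_tsum fun z' => ?_
      rw [setLIntegral_one]
      exact hSint z'

/-- Induction on the depth `K` of the approximation, with `Λ` independent of `K`; no a priori
finiteness of the exponential integral of `b` is needed. Since `L` is at least twice the
oscillation, the stopped set fills at most half of the cube and carries at most the fraction `θ` of
`μ`. The induction closes because `Λ` satisfies `hΛ`. -/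
theorem lintegral_expNorm_cubeMean_le {μ : Measure (E n)} {b : E n → ℂ}
    (hb : LocallyIntegrable b volume) (c : E n) {s : ℝ} (hs : 0 < s) {a : ℝ} (ha : 0 ≤ a)
    {L : ℝ≥0} (hL0 : L ≠ 0)
    (hL : ∀ k z, 2 * setAvg (gridCube c s k z) (fun x => ‖b x - cubeMean b c s k z‖ₑ) ≤ L)
    {θ : ℝ≥0∞}
    (hθ : ∀ k z, ∀ S ⊆ gridCube c s k z, MeasurableSet S →
      2 * volume S ≤ volume (gridCube c s k z) → μ S ≤ θ * μ (gridCube c s k z))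
    {Λ : ℝ≥0∞} (hΛ : ENNReal.ofReal (Real.exp (a * L)) +
      ENNReal.ofReal (Real.exp (a * (2 ^ n * L : ℝ≥0))) * Λ * θ ≤ Λ) (K : ℕ) :
    ∀ k z, ∫⁻ x in gridCube c s k z,
      expNorm a (cubeMean b c s (k + K) (gridIndex c s (k + K) x) - cubeMean b c s k z) ∂μ ≤
        Λ * μ (gridCube c s k z) := by
  induction K using Nat.strong_induction_on with
  | _ K ih =>
    intro k z
    have h0 := volume_gridCube_ne_zero c hs k z
    have ht := volume_gridCube_ne_top c hs k z
    obtain ⟨S, hS, hSm, hSL, hSint⟩ := exists_stopping_set hb c hs ha L Λ K ih K le_rfl k z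
      (cubeMean b c s k z) (le_trans (le_mul_of_one_le_left zero_le one_le_two) (hL k z))
    have hvol : 2 * volume S ≤ volume (gridCube c s k z) := by
      have hL' : (L : ℝ≥0∞) ≠ 0 := by exact_mod_cast hL0
      rw [← ENNReal.mul_le_mul_iff_right hL' ENNReal.coe_ne_top]
      calc L * (2 * volume S) = 2 * (L * volume S) := by ring
        _ ≤ 2 * ∫⁻ x in gridCube c s k z, ‖b x - cubeMean b c s k z‖ₑ := by
          gcongr
          exact hSL.trans (lintegral_mono_set hS)
        _ = volume (gridCube c s k z) *
            (2 * setAvg (gridCube c s k z) fun x => ‖b x - cubeMean b c s k z‖ₑ) := by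
          rw [← volume_mul_setAvg h0 ht]; ring
        _ ≤ volume (gridCube c s k z) * L := by gcongr; exact hL k z
        _ = _ := mul_comm _ _
    calc _ ≤ _ := hSint
      _ ≤ ENNReal.ofReal (Real.exp (a * L)) * μ (gridCube c s k z) +
          ENNReal.ofReal (Real.exp (a * (2 ^ n * L : ℝ≥0))) * Λ * (θ * μ (gridCube c s k z)) := by
        gcongr
        exact hθ k z S hS hSm hvol
      _ = (ENNReal.ofReal (Real.exp (a * L)) +
          ENNReal.ofReal (Real.exp (a * (2 ^ n * L : ℝ≥0))) * Λ * θ) *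
            μ (gridCube c s k z) := by ring
      _ ≤ _ := by gcongr

/-- Fatou's lemma: the dyadic means converge to `b` almost everywhere, also for `μ` by absolute
continuity. -/
theorem lintegral_expNorm_gridCube_le {μ : Measure (E n)} (hμ : μ ≪ volume) {b : E n → ℂ}
    (hb : LocallyIntegrable b volume) (c : E n) {s : ℝ} (hs : 0 < s) {a : ℝ} {Λ : ℝ≥0∞}
    (z : Fin n → ℤ)
    (h : ∀ K, ∫⁻ x in gridCube c s 0 z,
      expNorm a (cubeMean b c s K (gridIndex c s K x) - cubeMean b c s 0 z) ∂μ ≤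
        Λ * μ (gridCube c s 0 z)) :
    ∫⁻ x in gridCube c s 0 z, expNorm a (b x - cubeMean b c s 0 z) ∂μ ≤
      Λ * μ (gridCube c s 0 z) := by
  have hlim : ∀ᵐ x ∂(μ.restrict (gridCube c s 0 z)),
      expNorm a (b x - cubeMean b c s 0 z) = Filter.liminf (fun K =>
        expNorm a (cubeMean b c s K (gridIndex c s K x) - cubeMean b c s 0 z)) Filter.atTop := by
    filter_upwards [ae_restrict_of_ae (hμ.ae_le (ae_tendsto_cubeMean hb c hs))] with x hx
    exact (((continuous_expNorm a).tendsto _).comp (hx.sub_const _)).liminf_eq.symm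
  rw [lintegral_congr_ae hlim]
  refine (lintegral_liminf_le fun K => ?_).trans ?_
  · exact (Measurable.of_discrete (f := fun z' : Fin n → ℤ =>
      expNorm a (cubeMean b c s K z' - cubeMean b c s 0 z))).comp (measurable_gridIndex c s K)
  · refine Filter.liminf_le_of_frequently_le' (Filter.Frequently.of_forall h)

/-- The complement of `S` fills at least half of the cube, so comparison with the surrounding ball
gives it at least the fraction `D⁻¹` of `μ`. -/
theorem BallComparable.measure_le_of_two_mul_volume_le {μ : Measure (E n)} {C : ℝ≥0}
    (hμ : BallComparable μ C) (hfin : ∀ (c : E n) (r : ℝ), 0 < r → μ (Metric.ball c r) ≠ ⊤)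
    {D : ℝ≥0} (hD : 2 * C * ballCubeRatio n + 2 ≤ D) (c : E n) {s : ℝ} (hs : 0 < s) (k : ℕ)
    (z : Fin n → ℤ) {S : Set (E n)} (hS : S ⊆ gridCube c s k z) (hSm : MeasurableSet S)
    (hvol : 2 * volume S ≤ volume (gridCube c s k z)) :
    μ S ≤ ((1 - D⁻¹ : ℝ≥0) : ℝ≥0∞) * μ (gridCube c s k z) := by
  obtain ⟨x, hx⟩ := exists_mem_gridCube c hs k z
  have hsub := gridCube_subset_ball hs hx
  have hr : 0 < (n + 1 : ℝ) * (s / 2 ^ k) := by positivity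
  set Q := gridCube c s k z
  have hQ0 : volume Q ≠ 0 := volume_gridCube_ne_zero c hs k z
  have hQt : volume Q ≠ ⊤ := volume_gridCube_ne_top c hs k z
  have hQm : MeasurableSet Q := measurableSet_gridCube c s k z
  have hμQ : μ Q ≠ ⊤ := ne_top_of_le_ne_top (hfin x _ hr) (measure_mono hsub)
  have h1 : volume Q ≤ 2 * volume (Q \ S) := by
    have h : volume Q = volume S + volume (Q \ S) := by
      rw [measure_add_sdiff hSm.nullMeasurableSet, Set.union_eq_self_of_subset_left hS]
    have hSt : volume S ≠ ⊤ := ne_top_of_le_ne_top hQt (measure_mono hS)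
    rw [h, two_mul, ENNReal.add_le_add_iff_left hSt] at hvol
    rw [h, two_mul]
    gcongr
  have h2 : μ Q ≤ D * μ (Q \ S) := by
    rw [← ENNReal.mul_le_mul_iff_left hQ0 hQt]
    calc μ Q * volume Q
        ≤ μ (Metric.ball x ((n + 1) * (s / 2 ^ k))) * (2 * volume (Q \ S)) := by gcongr
      _ = 2 * (μ (Metric.ball x ((n + 1) * (s / 2 ^ k))) * volume (Q \ S)) := by ring
      _ ≤ 2 * (C * volume (Metric.ball x ((n + 1) * (s / 2 ^ k))) * μ (Q \ S)) :=
        mul_le_mul_right (hμ x _ hr (Q \ S) (hQm.diff hSm) (Set.sdiff_subset.trans hsub)) _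
      _ = (2 * C * ballCubeRatio n : ℝ≥0) * μ (Q \ S) * volume Q := by
        rw [volume_ball_eq_ballCubeRatio_mul c hs k z x]; push_cast; ring
      _ ≤ D * μ (Q \ S) * volume Q := by
        gcongr
        exact le_trans le_self_add hD
  have hD0 : D ≠ 0 := by
    intro h
    rw [h] at hD
    exact absurd (le_trans le_add_self hD) (by norm_num)
  have hD1 : D⁻¹ ≤ 1 := by
    rw [inv_le_one₀ (pos_iff_ne_zero.mpr hD0)]
    exact le_trans (by norm_num) (le_trans (le_add_self (a := (2 : ℝ≥0))) hD)
  have h3 : ((D⁻¹ : ℝ≥0) : ℝ≥0∞) * μ Q ≤ μ (Q \ S) := by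
    rw [ENNReal.coe_inv hD0]
    exact ENNReal.inv_mul_le_iff (by exact_mod_cast hD0) ENNReal.coe_ne_top |>.mpr h2
  have h4 : μ Q = μ S + μ (Q \ S) := by
    rw [measure_add_sdiff hSm.nullMeasurableSet, Set.union_eq_self_of_subset_left hS]
  have h5 : μ Q = ((1 - D⁻¹ : ℝ≥0) : ℝ≥0∞) * μ Q + ((D⁻¹ : ℝ≥0) : ℝ≥0∞) * μ Q := by
    rw [← add_mul, ← ENNReal.coe_add, tsub_add_cancel_of_le hD1, ENNReal.coe_one, one_mul]
  have h6 : μ S + ((D⁻¹ : ℝ≥0) : ℝ≥0∞) * μ Q ≤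
      ((1 - D⁻¹ : ℝ≥0) : ℝ≥0∞) * μ Q + ((D⁻¹ : ℝ≥0) : ℝ≥0∞) * μ Q := by
    rw [← h5]
    nth_rewrite 2 [h4]
    gcongr
  rwa [ENNReal.add_le_add_iff_right (ENNReal.mul_ne_top ENNReal.coe_ne_top hμQ)] at h6

/-- The John-Nirenberg inequality on balls, with respect to a measure of class `A₁`. -/
theorem exists_john_nirenberg {μ : Measure (E n)} (hac : μ ≪ volume) {C : ℝ≥0}
    (hμ : BallComparable μ C) (hfin : ∀ (c : E n) (r : ℝ), 0 < r → μ (Metric.ball c r) ≠ ⊤) :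
    ∃ a : ℝ, 0 < a ∧ ∃ Λ : ℝ≥0, ∀ (b : E n → ℂ), LocallyIntegrable b volume →
      ∀ M : ℝ≥0, 0 < M → bmoNorm b ≤ M → ∀ (c : E n) (r : ℝ), 0 < r →
        ∫⁻ x in Metric.ball c r, expNorm (a / M) (b x - ⨍ y in Metric.ball c r, b y) ∂μ ≤
          Λ * μ (Metric.ball c r) := by
  -- The summand 2 forces `D⁻¹ ≤ 1/2`, so that `θ` lies strictly between 0 and 1.
  set D : ℝ≥0 := 2 * C * ballCubeRatio n + 2 with hD
  set θ : ℝ≥0 := 1 - D⁻¹ with hθ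
  have hD2 : 2 ≤ D := le_add_self
  have hDi : D⁻¹ ≤ 2⁻¹ := inv_anti₀ two_pos hD2
  have hDpos : 0 < D⁻¹ := by positivity
  have hθr : (θ : ℝ) = 1 - (D : ℝ)⁻¹ := by
    rw [hθ, NNReal.coe_sub (hDi.trans (by norm_num [inv_le_one_of_one_le₀]))]
    simp
  have hDi' : (D : ℝ)⁻¹ ≤ 2⁻¹ := by exact_mod_cast hDi
  have hDpos' : 0 < (D : ℝ)⁻¹ := by exact_mod_cast hDpos
  have hθ0 : (0 : ℝ) < θ := by rw [hθr]; linarith [show (2 : ℝ)⁻¹ = 1 / 2 by norm_num]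
  have hθ1 : (θ : ℝ) < 1 := by rw [hθr]; linarith
  set K : ℝ≥0 := ballCubeRatio n + 1 with hK
  -- Makes `e^y θ = (1 + θ)/2 < 1`. The choice of `a` below gives `(a/M) 2^n L = y`, so a generation
  -- of stopped cubes contributes with a factor below 1.
  set y : ℝ := Real.log ((1 + θ) / (2 * θ)) with hy
  have hypos : 0 < y := Real.log_pos (by rw [lt_div_iff₀ (by positivity)]; linarith)
  have hexpy : Real.exp y * θ = (1 + θ) / 2 := by
    rw [hy, Real.exp_log (by positivity)]
    field_simp
  set a : ℝ := y / (2 ^ n * (4 * K)) with ha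
  have hKpos : (0 : ℝ) < K := by rw [hK]; positivity
  have hapos : 0 < a := by positivity
  -- The solution of `e^y + e^y θ Λ = Λ`.
  set Λ : ℝ≥0 := (Real.exp y * (2 / (1 - θ))).toNNReal with hΛ
  have hΛr : (Λ : ℝ) = Real.exp y * (2 / (1 - θ)) :=
    Real.coe_toNNReal _ (mul_nonneg (Real.exp_pos _).le (div_nonneg two_pos.le (by linarith)))
  set T : ℝ≥0 := (4 * (n + 1)) ^ n * (2 * K) with hT
  refine ⟨a, hapos, (Real.exp (a * T)).toNNReal * (Λ * (C * ((4 * (n + 1)) ^ n : ℝ≥0))), ?_⟩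
  intro b hb M hM hbM c r hr
  set s : ℝ := 4 * r with hs
  have hspos : 0 < s := by positivity
  -- The cube of index 0 with this corner and side `4r` is centred at `c`. It contains `B(c, r)` and
  -- lies in `B(c, 4(n+1)r)`.
  set c' : E n := WithLp.toLp 2 fun i => c i - 2 * r with hc'
  have hc'i : ∀ i, c' i = c i - 2 * r := fun i => rfl
  set L : ℝ≥0 := 4 * K * M with hL
  have haL : a / M * (2 ^ n * L : ℝ≥0) = y := by
    rw [ha, hL]
    push_cast
    have : (M : ℝ) ≠ 0 := by exact_mod_cast hM.ne'
    field_simp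
  have haL1 : a / M * (L : ℝ) ≤ y := by
    rw [← haL]
    have h1 : (L : ℝ) ≤ (2 ^ n * L : ℝ≥0) := by
      push_cast
      exact le_mul_of_one_le_left L.2 (one_le_pow₀ one_le_two)
    gcongr
  have haM : 0 ≤ a / M := by positivity
  have hosc : ∀ k z,
      2 * setAvg (gridCube c' s k z) (fun x => ‖b x - cubeMean b c' s k z‖ₑ) ≤ L := by
    intro k z
    calc _ ≤ 2 * (2 * (ballCubeRatio n : ℝ≥0∞) * bmoNorm b) := by
          gcongr
          exact setAvg_gridCube_le hb c' hspos k z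
      _ ≤ 2 * (2 * (K : ℝ≥0∞) * M) := by
          gcongr
          exact le_self_add
      _ = L := by rw [hL]; push_cast; ring
  have hmain := fun N => lintegral_expNorm_cubeMean_le (μ := μ) hb c' hspos haM (L := L)
    (by positivity) hosc (θ := θ)
    (fun k z S hS hSm h => hμ.measure_le_of_two_mul_volume_le hfin le_rfl c' hspos k z hS hSm h)
    (Λ := Λ) (by
      rw [haL]
      calc _ ≤ ENNReal.ofReal (Real.exp y) + ENNReal.ofReal (Real.exp y) * Λ * θ := by gcongr
        _ = ENNReal.ofReal (Real.exp y + Real.exp y * Λ * θ) := by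
          rw [ENNReal.ofReal_add (by positivity) (by positivity),
            ENNReal.ofReal_mul (by positivity), ENNReal.ofReal_mul (by positivity)]
          simp
        _ = ENNReal.ofReal Λ := by
          congr 1
          have h1 : (1 - (θ : ℝ)) ≠ 0 := by linarith
          calc Real.exp y + Real.exp y * Λ * θ = Real.exp y + (Real.exp y * θ) * Λ := by ring
            _ = Real.exp y + (1 + θ) / 2 * (Real.exp y * (2 / (1 - θ))) := by rw [hexpy, hΛr]
            _ = Λ := by rw [hΛr]; field_simp; ring
        _ = Λ := by simp) N 0 (0 : Fin n → ℤ)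
  have hcube := lintegral_expNorm_gridCube_le hac hb c' hspos (a := a / M) (Λ := Λ) 0
    (fun N => by simpa only [zero_add] using hmain N)
  set Q := gridCube c' s 0 (0 : Fin n → ℤ) with hQ
  have hBQ : Metric.ball c r ⊆ Q := by
    intro x hx
    rw [hQ, mem_gridCube_iff c' hspos]
    intro i
    have h1 : |x i - c i| < r := by
      have := PiLp.norm_apply_le (x - c) i
      rw [Metric.mem_ball, dist_eq_norm] at hx
      exact lt_of_le_of_lt (by simpa using this) hx
    rw [abs_lt] at h1
    simp only [hc'i, Set.mem_Ico, hs]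
    norm_num
    constructor <;> linarith
  have hcQ : c ∈ Q := hBQ (Metric.mem_ball_self hr)
  have hQB : Q ⊆ Metric.ball c ((4 * (n + 1)) * r) := by
    have := gridCube_subset_ball hspos hcQ
    refine this.trans (le_of_eq ?_)
    congr 1
    rw [hs]
    ring
  have hμQ : μ Q ≤ (C * ((4 * (n + 1)) ^ n : ℝ≥0) : ℝ≥0) * μ (Metric.ball c r) := by
    refine (measure_mono hQB).trans ((hμ.measure_ball_mul_le c hr (k := 4 * (n + 1)) ?_).trans ?_)
    · have : (0 : ℝ) ≤ n := by positivity
      linarith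
    · refine le_of_eq ?_
      congr 1
      rw [ENNReal.coe_mul]
      congr 1
      rw [ENNReal.ofReal]
      congr 1
      rw [Real.toNNReal_eq_iff_eq_coe (by positivity)]
      push_cast
      ring
  -- The mean over the cube and the mean over the ball differ by at most `T M`, which costs only the
  -- factor `exp (a T)`, independent of `b`.
  have hshift : ‖cubeMean b c' s 0 0 - ⨍ y in Metric.ball c r, b y‖ₑ ≤ (T * M : ℝ≥0) := by
    have hvol : volume Q ≤ ((4 * (n + 1)) ^ n : ℝ≥0) * volume (Metric.ball c r) := by
      refine (measure_mono hQB).trans (le_of_eq ?_)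
      rw [volume_ball_mul c (by positivity)]
      congr 1
      rw [ENNReal.ofReal]
      congr 1
      rw [Real.toNNReal_eq_iff_eq_coe (by positivity)]
      push_cast
      ring
    rw [enorm_sub_rev]
    refine (enorm_average_sub_le (volume_ball_ne_zero c hr) (volume_ball_ne_top c r)
      ((hb.integrableOn_isCompact (isCompact_closedBall c r)).mono_set
        Metric.ball_subset_closedBall) _).trans ?_
    refine (setAvg_le_mul_setAvg hBQ hvol (volume_ball_ne_zero c hr)
      (volume_gridCube_ne_top c' hspos 0 0) _).trans ?_
    calc _ ≤ (((4 * (n + 1)) ^ n : ℝ≥0) : ℝ≥0∞) * (2 * ballCubeRatio n * bmoNorm b) := by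
          gcongr
          exact setAvg_gridCube_le hb c' hspos 0 0
      _ ≤ (((4 * (n + 1)) ^ n : ℝ≥0) : ℝ≥0∞) * (2 * K * M) := by
          gcongr
          exact le_self_add
      _ = _ := by rw [hT]; push_cast; ring
  calc ∫⁻ x in Metric.ball c r, expNorm (a / M) (b x - ⨍ y in Metric.ball c r, b y) ∂μ
      ≤ ∫⁻ x in Q, expNorm (a / M) (b x - ⨍ y in Metric.ball c r, b y) ∂μ := lintegral_mono_set hBQ
    _ ≤ ∫⁻ x in Q, ENNReal.ofReal (Real.exp (a / M * (T * M : ℝ≥0))) *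
        expNorm (a / M) (b x - cubeMean b c' s 0 0) ∂μ :=
      lintegral_mono fun x => expNorm_sub_le haM hshift
    _ = ENNReal.ofReal (Real.exp (a / M * (T * M : ℝ≥0))) *
        ∫⁻ x in Q, expNorm (a / M) (b x - cubeMean b c' s 0 0) ∂μ :=
      lintegral_const_mul' _ _ ENNReal.ofReal_ne_top
    _ ≤ ENNReal.ofReal (Real.exp (a * T)) * (Λ * ((C * ((4 * (n + 1)) ^ n : ℝ≥0) : ℝ≥0) *
        μ (Metric.ball c r))) := by
      have h1 : a / M * (T * M : ℝ≥0) = a * T := by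
        push_cast
        have : (M : ℝ) ≠ 0 := by exact_mod_cast hM.ne'
        field_simp
      rw [h1]
      gcongr
      exact hcube.trans (by gcongr)
    _ = _ := by
      rw [ENNReal.ofReal]
      push_cast
      ring

end JohnNirenberg

end MorreyLLogL

namespace MorreyLLogL

/-! ### The Young function and its iterates. -/

section YoungFunction

theorem Phi_zero : Phi 0 = 0 := by simp [Phi]

theorem le_Phi {t : ℝ} (ht : 0 ≤ t) : t ≤ Phi t := by
  unfold Phi
  nlinarith [mul_nonneg ht (le_max_right (Real.log t) 0)]

theorem Phi_nonneg {t : ℝ} (ht : 0 ≤ t) : 0 ≤ Phi t := ht.trans (le_Phi ht)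

theorem measurable_Phi : Measurable Phi := by
  unfold Phi
  fun_prop

theorem Phi_le_Phi {s t : ℝ} (hs : 0 ≤ s) (hst : s ≤ t) : Phi s ≤ Phi t := by
  rcases hs.eq_or_lt with rfl | hs'
  · rw [Phi_zero]
    exact Phi_nonneg hst
  · unfold Phi
    have : 0 ≤ t := hs.trans hst
    gcongr

theorem Phi_mul_le {C t : ℝ} (hC : 1 ≤ C) (ht : 0 ≤ t) : Phi (C * t) ≤ C ^ 2 * Phi t := by
  rcases ht.eq_or_lt with rfl | ht'
  · simp [Phi_zero]
  · have hC0 : 0 < C := by linarith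
    have h1 : max (Real.log (C * t)) 0 ≤ (C - 1) + max (Real.log t) 0 := by
      rw [Real.log_mul hC0.ne' ht'.ne']
      have h2 := Real.log_le_sub_one_of_pos hC0
      refine max_le ?_ ?_
      · linarith [le_max_left (Real.log t) 0]
      · linarith [le_max_right (Real.log t) 0]
    have h3 : 0 ≤ max (Real.log t) 0 := le_max_right _ _
    unfold Phi
    calc C * t * (1 + max (Real.log (C * t)) 0)
        ≤ C * t * (C * (1 + max (Real.log t) 0)) := by
          gcongr
          nlinarith
      _ = _ := by ring

/-- Young's inequality for `s log s` and `exp`: it is `u + 1 ≤ e^u` at `u = t - log s`, multiplied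
by `s`. -/
theorem mul_le_Phi_add_exp {s t : ℝ} (hs : 0 ≤ s) : s * t ≤ Phi s + Real.exp t := by
  rcases hs.eq_or_lt with rfl | hs'
  · simp [Phi_zero, (Real.exp_pos t).le]
  · have h1 := Real.add_one_le_exp (t - Real.log s)
    rw [Real.exp_sub, Real.exp_log hs', le_div_iff₀ hs'] at h1
    have h2 : s * Real.log s ≤ s * max (Real.log s) 0 := by
      gcongr
      exact le_max_left _ _
    unfold Phi
    nlinarith

theorem iterate_Phi_zero (k : ℕ) : Phi^[k] 0 = 0 :=
  Function.iterate_fixed Phi_zero k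

theorem le_iterate_Phi (k : ℕ) {t : ℝ} (ht : 0 ≤ t) : t ≤ Phi^[k] t := by
  induction k with
  | zero => exact le_rfl
  | succ k ih =>
    rw [Function.iterate_succ_apply']
    exact ih.trans (le_Phi (ht.trans ih))

theorem iterate_Phi_nonneg (k : ℕ) {t : ℝ} (ht : 0 ≤ t) : 0 ≤ Phi^[k] t :=
  ht.trans (le_iterate_Phi k ht)

theorem measurable_iterate_Phi (k : ℕ) : Measurable Phi^[k] := measurable_Phi.iterate k

theorem exists_iterate_Phi_mul_two_le (k : ℕ) :
    ∃ D : ℝ, 1 ≤ D ∧ ∀ t : ℝ, 0 ≤ t → Phi^[k] (2 * t) ≤ D * Phi^[k] t := by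
  induction k with
  | zero => exact ⟨2, one_le_two, fun t _ => le_rfl⟩
  | succ k ih =>
    obtain ⟨D, hD1, hD⟩ := ih
    refine ⟨D ^ 2, one_le_pow₀ hD1, fun t ht => ?_⟩
    rw [Function.iterate_succ_apply', Function.iterate_succ_apply']
    exact (Phi_le_Phi (iterate_Phi_nonneg k (by positivity)) (hD t ht)).trans
      (Phi_mul_le hD1 (iterate_Phi_nonneg k ht))

end YoungFunction

/-! ### Luxemburg norms and their pairing with functions of bounded mean oscillation. -/

section Luxemburg

variable {n : ℕ}

/-- Bounds by a Luxemburg norm are checked on admissible `σ`. The constant is divided out before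
taking the infimum, hence `K` must be nonzero and finite. -/
theorem le_mul_luxNorm {w g : E n → ℝ} {c : E n} {r : ℝ} {X K : ℝ≥0∞} (hK0 : K ≠ 0)
    (hKt : K ≠ ⊤)
    (h : ∀ σ : ℝ≥0, 0 < σ → (wMeasure w (Metric.ball c r))⁻¹ *
      ∫⁻ x in Metric.ball c r, ENNReal.ofReal (Phi (|g x| / σ)) ∂(wMeasure w) ≤ 1 → X ≤ K * σ) :
    X ≤ K * luxNorm w g c r := by
  rw [← ENNReal.inv_mul_le_iff hK0 hKt]
  refine le_iInf fun σ => le_iInf fun hσ => le_iInf fun hσ' => ?_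
  rw [ENNReal.inv_mul_le_iff hK0 hKt]
  exact h σ hσ hσ'

theorem IsWeight.wMeasure_ball_ne_zero {w : E n → ℝ} (hw : IsWeight w) (c : E n) {r : ℝ}
    (hr : 0 < r) : wMeasure w (Metric.ball c r) ≠ 0 :=
  MorreyLLogL.wMeasure_ball_ne_zero hw.ae_pos hw.aemeasurable c hr

theorem IsWeight.lintegral_Phi_le {w : E n → ℝ} (hw : IsWeight w) {g : E n → ℝ} {c : E n}
    {r : ℝ} (hr : 0 < r) {σ : ℝ≥0} (h : (wMeasure w (Metric.ball c r))⁻¹ *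
      ∫⁻ x in Metric.ball c r, ENNReal.ofReal (Phi (|g x| / σ)) ∂(wMeasure w) ≤ 1) :
    ∫⁻ x in Metric.ball c r, ENNReal.ofReal (Phi (|g x| / σ)) ∂(wMeasure w) ≤
      wMeasure w (Metric.ball c r) := by
  rwa [ENNReal.inv_mul_le_iff (hw.wMeasure_ball_ne_zero c hr) (hw.wMeasure_ball_ne_top c r),
    mul_one] at h

theorem ofReal_le_mul_ofReal_Phi (t : ℝ) {σ : ℝ≥0} (hσ : 0 < σ) :
    ENNReal.ofReal t ≤ σ * ENNReal.ofReal (Phi (|t| / σ)) := by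
  have hσ' : (0 : ℝ) < σ := hσ
  have h1 : (σ : ℝ≥0∞) = ENNReal.ofReal σ := by simp
  rw [h1, ← ENNReal.ofReal_mul hσ'.le]
  refine ENNReal.ofReal_le_ofReal ?_
  calc t ≤ |t| := le_abs_self t
    _ = σ * (|t| / σ) := by field_simp
    _ ≤ _ := by
      gcongr
      exact le_Phi (by positivity)

theorem IsWeight.lintegral_le_mul_luxNorm {w : E n → ℝ} (hw : IsWeight w) (g : E n → ℝ)
    (c : E n) {r : ℝ} (hr : 0 < r) :
    ∫⁻ x in Metric.ball c r, ENNReal.ofReal (g x) ∂(wMeasure w) ≤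
      wMeasure w (Metric.ball c r) * luxNorm w g c r := by
  refine le_mul_luxNorm (hw.wMeasure_ball_ne_zero c hr) (hw.wMeasure_ball_ne_top c r)
    fun σ hσ h => ?_
  calc _ ≤ ∫⁻ x in Metric.ball c r, σ * ENNReal.ofReal (Phi (|g x| / σ)) ∂(wMeasure w) :=
        lintegral_mono fun x => ofReal_le_mul_ofReal_Phi (g x) hσ
    _ = σ * ∫⁻ x in Metric.ball c r, ENNReal.ofReal (Phi (|g x| / σ)) ∂(wMeasure w) :=
        lintegral_const_mul' _ _ ENNReal.coe_ne_top
    _ ≤ σ * wMeasure w (Metric.ball c r) := by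
        gcongr
        exact hw.lintegral_Phi_le hr h
    _ = _ := mul_comm _ _

theorem le_inv_mul_of_mul_le {a b c : ℝ≥0∞} (h0 : a ≠ 0) (ht : a ≠ ⊤) (h : a * b ≤ c) :
    b ≤ a⁻¹ * c := by
  rwa [mul_comm, ← div_eq_mul_inv, ENNReal.le_div_iff_mul_le (Or.inl h0) (Or.inl ht), mul_comm]

theorem IsWeight.lintegral_volume_le_mul_luxNorm {w : E n → ℝ} (hw : IsWeight w) {g : E n → ℝ}
    (hg : AEMeasurable g volume) (c : E n) {r : ℝ} (hr : 0 < r) (he : ballEssInf w c r ≠ 0) :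
    ∫⁻ x in Metric.ball c r, ENNReal.ofReal (g x) ≤
      (ballEssInf w c r)⁻¹ * (wMeasure w (Metric.ball c r) * luxNorm w g c r) := by
  have h := (ballEssInf_mul_lintegral_le hw.aemeasurable c r hg.ennreal_ofReal).trans
    (hw.lintegral_le_mul_luxNorm g c hr)
  exact le_inv_mul_of_mul_le he (hw.ballEssInf_ne_top c hr) h

theorem enorm_mul_ofReal_le {a : ℝ} (ha : 0 < a) {M σ : ℝ≥0} (hM : 0 < M) (hσ : 0 < σ) (z : ℂ)
    (t : ℝ) : ‖z‖ₑ * ENNReal.ofReal t ≤ ENNReal.ofReal a⁻¹ * M * σ *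
      (ENNReal.ofReal (Phi (|t| / σ)) + expNorm (a / M) z) := by
  have hσ' : (0 : ℝ) < σ := hσ
  have hM' : (0 : ℝ) < M := hM
  have h1 : (σ : ℝ≥0∞) = ENNReal.ofReal σ := by simp
  have h2 : (M : ℝ≥0∞) = ENNReal.ofReal M := by simp
  rw [h1, h2, expNorm, ← ENNReal.ofReal_add (Phi_nonneg (by positivity)) (Real.exp_pos _).le,
    ← ENNReal.ofReal_mul (by positivity), ← ENNReal.ofReal_mul (by positivity),
    ← ENNReal.ofReal_mul (by positivity), ← ofReal_norm, ← ENNReal.ofReal_mul (norm_nonneg z)]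
  refine ENNReal.ofReal_le_ofReal ?_
  calc ‖z‖ * t ≤ ‖z‖ * |t| := by gcongr; exact le_abs_self t
    _ = a⁻¹ * M * σ * ((|t| / σ) * (a / M * ‖z‖)) := by field_simp
    _ ≤ _ := by
      gcongr
      exact mul_le_Phi_add_exp (by positivity)

/-- The generalized Hölder inequality between `L log L` with respect to a weight and the
exponential class, for functions of bounded mean oscillation. -/
theorem exists_lintegral_sub_average_mul_le (n : ℕ) :
    ∃ C : ℝ≥0, ∀ (b : E n → ℂ), LocallyIntegrable b volume →
      ∀ M : ℝ≥0, 0 < M → bmoNorm b ≤ M → ∀ (w : E n → ℝ), IsWeight w →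
      ∀ g : E n → ℝ, AEMeasurable g volume → ∀ (c : E n) (r : ℝ), 0 < r → ballEssInf w c r ≠ 0 →
        ∫⁻ x in Metric.ball c r, ‖b x - ⨍ y in Metric.ball c r, b y‖ₑ * ENNReal.ofReal (g x) ≤
          C * M * ((ballEssInf w c r)⁻¹ * (wMeasure w (Metric.ball c r) * luxNorm w g c r)) := by
  -- John-Nirenberg for Lebesgue measure suffices for an arbitrary weight: the exponential integral
  -- is at most `Λ |B|`, and `|B| ≤ w(B) / ess inf_B w`.
  obtain ⟨a, ha, Λ, hΛ⟩ := exists_john_nirenberg (n := n) Measure.AbsolutelyContinuous.rfl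
    ballComparable_volume fun c r _ => volume_ball_ne_top c r
  refine ⟨a⁻¹.toNNReal * (1 + Λ), fun b hb M hM hbM w hw g hg c r hr he => ?_⟩
  have hwB0 := hw.wMeasure_ball_ne_zero c hr
  have hwBt := hw.wMeasure_ball_ne_top c r
  have het := hw.ballEssInf_ne_top c hr
  have hC : ((a⁻¹.toNNReal * (1 + Λ) : ℝ≥0) : ℝ≥0∞) = ENNReal.ofReal a⁻¹ * (1 + Λ) := by
    push_cast
    rfl
  have ha0 : ENNReal.ofReal a⁻¹ ≠ 0 := by simpa using ha
  have hM0 : (M : ℝ≥0∞) ≠ 0 := by exact_mod_cast hM.ne'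
  rw [hC]
  have key : ∫⁻ x in Metric.ball c r,
      ‖b x - ⨍ y in Metric.ball c r, b y‖ₑ * ENNReal.ofReal (g x) ≤
      (ENNReal.ofReal a⁻¹ * (1 + Λ) * M * (ballEssInf w c r)⁻¹ *
        wMeasure w (Metric.ball c r)) * luxNorm w g c r := by
    refine le_mul_luxNorm ?_ ?_ fun σ hσ h => ?_
    · simp [ha0, hM0, hwB0, het]
    · finiteness
    · have hgm : AEMeasurable (fun x => ENNReal.ofReal (Phi (|g x| / σ))) volume :=
        (measurable_Phi.comp_aemeasurable (hg.abs.div_const _)).ennreal_ofReal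
      have h1 : ∫⁻ x in Metric.ball c r, ENNReal.ofReal (Phi (|g x| / σ)) ≤
          (ballEssInf w c r)⁻¹ * wMeasure w (Metric.ball c r) := by
        refine le_inv_mul_of_mul_le he het ?_
        exact (ballEssInf_mul_lintegral_le hw.aemeasurable c r hgm).trans
          (hw.lintegral_Phi_le hr h)
      have h2 : volume (Metric.ball c r) ≤
          (ballEssInf w c r)⁻¹ * wMeasure w (Metric.ball c r) := by
        refine le_inv_mul_of_mul_le he het ?_
        exact ballEssInf_mul_volume_le hw.aemeasurable c r
      calc _ ≤ ∫⁻ x in Metric.ball c r, ENNReal.ofReal a⁻¹ * M * σ *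
            (ENNReal.ofReal (Phi (|g x| / σ)) +
              expNorm (a / M) (b x - ⨍ y in Metric.ball c r, b y)) :=
            lintegral_mono fun x => enorm_mul_ofReal_le ha hM hσ _ _
        _ = ENNReal.ofReal a⁻¹ * M * σ *
            ((∫⁻ x in Metric.ball c r, ENNReal.ofReal (Phi (|g x| / σ))) +
              ∫⁻ x in Metric.ball c r,
                expNorm (a / M) (b x - ⨍ y in Metric.ball c r, b y)) := by
            rw [lintegral_const_mul' _ _ (by finiteness), lintegral_add_left' hgm.restrict]
        _ ≤ ENNReal.ofReal a⁻¹ * M * σ *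
            ((ballEssInf w c r)⁻¹ * wMeasure w (Metric.ball c r) +
              Λ * ((ballEssInf w c r)⁻¹ * wMeasure w (Metric.ball c r))) := by
            gcongr
            exact (hΛ b hb M hM hbM c r hr).trans (by gcongr)
        _ = _ := by ring
  refine key.trans (le_of_eq ?_)
  ring

/-- Telescoping over successive doublings. The linear growth in `j` is the source of the factor `j +
1` in the next estimate. -/
theorem enorm_average_ball_sub_le {b : E n → ℂ} (hb : LocallyIntegrable b volume) (c : E n)
    {r : ℝ} (hr : 0 < r) (j : ℕ) :
    ‖(⨍ y in Metric.ball c r, b y) - ⨍ y in Metric.ball c (2 ^ j * r), b y‖ₑ ≤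
      j * (2 ^ n * bmoNorm b) := by
  induction j with
  | zero => simp
  | succ j ih =>
    set β : ℕ → ℂ := fun k => ⨍ y in Metric.ball c (2 ^ k * r), b y with hβ
    have hrj : 0 < 2 ^ j * r := by positivity
    have h1 : ‖β j - β (j + 1)‖ₑ ≤ 2 ^ n * bmoNorm b := by
      have h2 : (2 : ℝ) ^ (j + 1) * r = 2 * (2 ^ j * r) := by ring
      have hvol : volume (Metric.ball c (2 ^ (j + 1) * r)) ≤
          2 ^ n * volume (Metric.ball c (2 ^ j * r)) := by
        rw [h2, volume_ball_mul c two_pos, ENNReal.ofReal_pow two_pos.le]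
        simp
      refine (enorm_average_sub_le (volume_ball_ne_zero c hrj) (volume_ball_ne_top c _)
        ((hb.integrableOn_isCompact (isCompact_closedBall c (2 ^ j * r))).mono_set
          Metric.ball_subset_closedBall) (β (j + 1))).trans ?_
      refine (setAvg_le_mul_setAvg (Metric.ball_subset_ball (by rw [h2]; linarith)) hvol
        (volume_ball_ne_zero c hrj) (volume_ball_ne_top c _) _).trans ?_
      gcongr
      exact ballAvg_sub_average_le_bmoNorm b c (by positivity)
    have h3 : (⨍ y in Metric.ball c r, b y) - β (j + 1) =
        ((⨍ y in Metric.ball c r, b y) - β j) + (β j - β (j + 1)) := by ring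
    change ‖(⨍ y in Metric.ball c r, b y) - β (j + 1)‖ₑ ≤ _
    rw [h3]
    calc _ ≤ ‖(⨍ y in Metric.ball c r, b y) - β j‖ₑ + ‖β j - β (j + 1)‖ₑ := enorm_add_le _ _
      _ ≤ j * (2 ^ n * bmoNorm b) + 2 ^ n * bmoNorm b := add_le_add ih h1
      _ = _ := by push_cast; ring

/-- The mean oscillation on the dilates of a ball, against a function in `L log L`. -/
theorem exists_lintegral_sub_mul_le (n : ℕ) :
    ∃ C : ℝ≥0, 1 ≤ C ∧ ∀ (b : E n → ℂ), LocallyIntegrable b volume →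
      ∀ M : ℝ≥0, 0 < M → bmoNorm b ≤ M → ∀ (w : E n → ℝ), IsWeight w →
      ∀ g : E n → ℝ, AEMeasurable g volume → ∀ (c : E n) (r : ℝ), 0 < r → ∀ (j : ℕ),
        ballEssInf w c (2 ^ j * r) ≠ 0 → ∀ x,
        ∫⁻ y in Metric.ball c (2 ^ j * r), ‖b x - b y‖ₑ * ENNReal.ofReal (g y) ≤
          (j + 1) * (C * (‖b x - ⨍ y in Metric.ball c r, b y‖ₑ + M)) *
            ((ballEssInf w c (2 ^ j * r))⁻¹ *
              (wMeasure w (Metric.ball c (2 ^ j * r)) * luxNorm w g c (2 ^ j * r))) := by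
  obtain ⟨C, hC⟩ := exists_lintegral_sub_average_mul_le n
  refine ⟨1 + 2 ^ n + C, by rw [add_assoc]; exact le_self_add, ?_⟩
  intro b hb M hM hbM w hw g hg c r hr j he x
  have hrj : 0 < 2 ^ j * r := by positivity
  set β := ⨍ y in Metric.ball c r, b y
  set β' := ⨍ y in Metric.ball c (2 ^ j * r), b y
  set Y := (ballEssInf w c (2 ^ j * r))⁻¹ *
    (wMeasure w (Metric.ball c (2 ^ j * r)) * luxNorm w g c (2 ^ j * r))
  set u := ‖b x - β‖ₑ
  have h1 : ∀ y, ‖b x - b y‖ₑ ≤ (u + j * (2 ^ n * M)) + ‖b y - β'‖ₑ := by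
    intro y
    have : b x - b y = ((b x - β) + (β - β')) - (b y - β') := by ring
    rw [this]
    calc _ ≤ ‖(b x - β) + (β - β')‖ₑ + ‖b y - β'‖ₑ := enorm_sub_le
      _ ≤ (‖b x - β‖ₑ + ‖β - β'‖ₑ) + ‖b y - β'‖ₑ := by gcongr; exact enorm_add_le _ _
      _ ≤ _ := by
        gcongr
        exact (enorm_average_ball_sub_le hb c hr j).trans (by gcongr)
  have hu : u + j * (2 ^ n * M) ≠ ⊤ := by finiteness
  calc _ ≤ ∫⁻ y in Metric.ball c (2 ^ j * r), ((u + j * (2 ^ n * M)) * ENNReal.ofReal (g y) +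
        ‖b y - β'‖ₑ * ENNReal.ofReal (g y)) := by
        refine lintegral_mono fun y => ?_
        rw [← add_mul]
        exact mul_le_mul_left (h1 y) _
    _ = (u + j * (2 ^ n * M)) * (∫⁻ y in Metric.ball c (2 ^ j * r), ENNReal.ofReal (g y)) +
        ∫⁻ y in Metric.ball c (2 ^ j * r), ‖b y - β'‖ₑ * ENNReal.ofReal (g y) := by
        rw [lintegral_add_left' ((hg.ennreal_ofReal.const_mul _).restrict),
          lintegral_const_mul' _ _ hu]
    _ ≤ (u + j * (2 ^ n * M)) * Y + C * M * Y :=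
        add_le_add (mul_le_mul_right (hw.lintegral_volume_le_mul_luxNorm hg c hrj he) _)
          (hC b hb M hM hbM w hw g hg c _ hrj he)
    _ = (1 * 1 * u + (j * 2 ^ n * M + 1 * C * M)) * Y := by ring
    _ ≤ ((j + 1) * (1 + 2 ^ n + C) * u + ((j + 1) * 2 ^ n * M + (j + 1) * (1 + C) * M)) * Y := by
        gcongr
        · exact le_add_self
        · rw [add_assoc]; exact le_self_add
        · exact le_self_add
        · exact le_add_self
        · exact le_add_self
    _ = _ := by push_cast; ring

end Luxemburg

end MorreyLLogL

namespace MorreyLLogL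

/-! ### Summation over the dyadic shells. -/

section FarPart

variable {n m : ℕ}

/-- Write `w(B) = w(B)^κ w(B)^{1-κ}`: the second power belongs to the Morrey norm, and the product
of the first ones is bounded through `ν` by the `A_∞` comparison. -/
theorem exists_prod_luxNorm_le (hm : m ≠ 0) {κ : ℝ} (hκ0 : 0 ≤ κ) {w : Fin m → E n → ℝ}
    (hw : ∀ i, IsWeight (w i)) (hw' : ∀ i, IsAInfty (w i)) :
    ∃ C : ℝ≥0, ∀ (g : Fin m → E n → ℝ) (c : E n) (r : ℝ), 0 < r →
      ∏ i, (wMeasure (w i) (Metric.ball c r) * luxNorm (w i) (g i) c r) ≤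
        C * (wMeasure (nu w) (Metric.ball c r) ^ m) ^ κ * ∏ i, morreyLLogL κ (w i) (g i) := by
  obtain ⟨C, hC⟩ := exists_prod_wMeasure_ball_le hm hw hw'
  refine ⟨C ^ κ, fun g c r hr => ?_⟩
  have h1 : ∀ i, wMeasure (w i) (Metric.ball c r) * luxNorm (w i) (g i) c r ≤
      wMeasure (w i) (Metric.ball c r) ^ κ * morreyLLogL κ (w i) (g i) := by
    intro i
    have h0 := (hw i).wMeasure_ball_ne_zero c hr
    have ht := (hw i).wMeasure_ball_ne_top c r
    calc _ = wMeasure (w i) (Metric.ball c r) ^ κ *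
          (wMeasure (w i) (Metric.ball c r) ^ (1 - κ) * luxNorm (w i) (g i) c r) := by
          rw [← mul_assoc, ← ENNReal.rpow_add _ _ h0 ht, add_sub_cancel, ENNReal.rpow_one]
      _ ≤ _ := by
          gcongr
          exact le_iSup_of_le c (le_iSup_of_le r (le_iSup_of_le hr le_rfl))
  calc _ ≤ ∏ i, (wMeasure (w i) (Metric.ball c r) ^ κ * morreyLLogL κ (w i) (g i)) :=
        Finset.prod_le_prod' fun i _ => h1 i
    _ = (∏ i, wMeasure (w i) (Metric.ball c r)) ^ κ * ∏ i, morreyLLogL κ (w i) (g i) := by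
        rw [Finset.prod_mul_distrib, ENNReal.prod_rpow_of_nonneg hκ0]
    _ ≤ (C * wMeasure (nu w) (Metric.ball c r) ^ m) ^ κ * ∏ i, morreyLLogL κ (w i) (g i) := by
        gcongr
        exact hC c r hr
    _ = _ := by
        rw [ENNReal.mul_rpow_of_nonneg _ _ hκ0, ENNReal.coe_rpow_of_nonneg _ hκ0]

theorem ofReal_abs_div_eq (A : ℝ) (c : E n) {r : ℝ} (hr : 0 < r) (j : ℕ) :
    ENNReal.ofReal (|A| / (2 ^ j * r) ^ (m * n)) =
      ENNReal.ofReal (|A| * 4 ^ (m * n)) * volume (Metric.ball (0 : E n) 1) ^ m *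
        (volume (Metric.ball c (2 ^ (j + 2) * r)))⁻¹ ^ m := by
  have h0 := volume_ball_ne_zero (0 : E n) one_pos
  have ht := volume_ball_ne_top (0 : E n) 1
  rw [Measure.addHaar_ball_of_pos volume c (by positivity : 0 < 2 ^ (j + 2) * r),
    finrank_euclideanSpace_fin,
    ENNReal.mul_inv (Or.inr ht) (Or.inr h0)]
  rw [show ENNReal.ofReal (|A| * 4 ^ (m * n)) * volume (Metric.ball (0 : E n) 1) ^ m *
      ((ENNReal.ofReal ((2 ^ (j + 2) * r) ^ n))⁻¹ *
        (volume (Metric.ball (0 : E n) 1))⁻¹) ^ m =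
      ENNReal.ofReal (|A| * 4 ^ (m * n)) * (volume (Metric.ball (0 : E n) 1) *
      (volume (Metric.ball (0 : E n) 1))⁻¹) ^ m *
        (ENNReal.ofReal ((2 ^ (j + 2) * r) ^ n))⁻¹ ^ m by ring]
  rw [ENNReal.mul_inv_cancel h0 ht, one_pow, mul_one, ← ENNReal.ofReal_inv_of_pos (by positivity),
    ← ENNReal.ofReal_pow (by positivity), ← ENNReal.ofReal_mul (by positivity)]
  congr 1
  rw [inv_pow, ← pow_mul, mul_comm n m]
  have : (2 : ℝ) ^ (j + 2) * r = 4 * (2 ^ j * r) := by ring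
  rw [this, mul_pow 4]
  field_simp

theorem tsum_pow_mul_pow_ne_top (m : ℕ) {ρ : ℝ≥0} (hρ : ρ < 1) :
    ∑' j : ℕ, (((j + 3 : ℝ≥0) ^ m * ρ ^ j : ℝ≥0) : ℝ≥0∞) ≠ ⊤ := by
  rw [ENNReal.tsum_coe_ne_top_iff_summable]
  rcases eq_or_ne ρ 0 with rfl | hρ0
  · refine summable_of_ne_finset_zero (s := {0}) fun j hj => ?_
    rw [zero_pow (by simpa using hj), mul_zero]
  · have h1 : Summable fun j : ℕ => ((j : ℝ)) ^ m * (ρ : ℝ) ^ j :=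
      summable_pow_mul_geometric_of_norm_lt_one m (by simpa using hρ)
    have h2 := (summable_nat_add_iff 3).mpr h1
    rw [← NNReal.summable_coe]
    refine (h2.mul_left ((ρ : ℝ) ^ 3)⁻¹).congr fun j => ?_
    have : (ρ : ℝ) ≠ 0 := by exact_mod_cast hρ0
    push_cast
    rw [pow_add]
    field_simp

/-- The numbers `I j i` stand for the integrals over the dilates and `H i` for the factors depending
on `x`; in this form the bound serves both commutators. Each term is at most a constant times
`(j+3)^m ν(2^{j+2}B)^{m(κ-1)}`, summable by reverse doubling. -/
theorem exists_tsum_far_le (hn : n ≠ 0) (hm : m ≠ 0) {κ : ℝ} (hκ0 : 0 < κ) (hκ1 : κ < 1)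
    {w : Fin m → E n → ℝ} (hw : IsMultiA1 w) (hw' : ∀ i, IsAInfty (w i)) (A : ℝ) :
    ∃ C : ℝ≥0, ∀ (g : Fin m → E n → ℝ) (c : E n) (r : ℝ), 0 < r →
      ∀ (I : ℕ → Fin m → ℝ≥0∞) (H : Fin m → ℝ≥0∞),
      (∀ j i, I j i ≤ ((j + 2 : ℕ) + 1) * H i * ((ballEssInf (w i) c (2 ^ (j + 2) * r))⁻¹ *
        (wMeasure (w i) (Metric.ball c (2 ^ (j + 2) * r)) *
          luxNorm (w i) (g i) c (2 ^ (j + 2) * r)))) →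
      ∑' j : ℕ, ENNReal.ofReal (|A| / (2 ^ j * r) ^ (m * n)) * ∏ i, I j i ≤
        C * (wMeasure (nu w) (Metric.ball c r) ^ m) ^ (κ - 1) *
          (∏ i, H i) * ∏ i, morreyLLogL κ (w i) (g i) := by
  obtain ⟨C₁, hC₁⟩ := hw.2
  obtain ⟨C₂, hC₂⟩ := exists_prod_luxNorm_le hm hκ0.le hw.1 hw'
  obtain ⟨C₃, hC₃1, hC₃⟩ := hw.exists_ballComparable hm
  obtain ⟨γ, hγ1, hγ⟩ := hC₃.exists_reverse_doubling hn hC₃1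
  have hγ0 : γ ≠ 0 := (zero_lt_one.trans hγ1).ne'
  -- The ratio of the geometric series, below 1 because `γ > 1` and `κ < 1`.
  set ρ : ℝ≥0 := (γ ^ m) ^ (κ - 1) with hρ
  have hρ1 : ρ < 1 :=
    NNReal.rpow_lt_one_of_one_lt_of_neg (one_lt_pow₀ hγ1 hm) (by linarith)
  set S := ∑' j : ℕ, (((j + 3 : ℝ≥0) ^ m * ρ ^ j : ℝ≥0) : ℝ≥0∞) with hS
  have hSt : S ≠ ⊤ := tsum_pow_mul_pow_ne_top m hρ1
  set A' : ℝ≥0∞ := ENNReal.ofReal (|A| * 4 ^ (m * n)) *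
    volume (Metric.ball (0 : E n) 1) ^ m with hA'
  have hA't : A' ≠ ⊤ :=
    ENNReal.mul_ne_top ENNReal.ofReal_ne_top (ENNReal.pow_ne_top (volume_ball_ne_top _ _))
  refine ⟨(A' * C₁ * C₂ * S).toNNReal, fun g c r hr I H hI => ?_⟩
  rw [ENNReal.coe_toNNReal (by finiteness)]
  set V := wMeasure (nu w) (Metric.ball c r) with hV
  have hV0 : V ≠ 0 := wMeasure_nu_ball_ne_zero hw.1 c hr
  have hVt : V ≠ ⊤ := hw.wMeasure_nu_ball_ne_top hm c hr
  set P := ∏ i, H i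
  set G := ∏ i, morreyLLogL κ (w i) (g i)
  have term : ∀ j : ℕ, ENNReal.ofReal (|A| / (2 ^ j * r) ^ (m * n)) * ∏ i, I j i ≤
      (A' * C₁ * C₂ * (V ^ m) ^ (κ - 1) * P * G) *
        (((j + 3 : ℝ≥0) ^ m * ρ ^ j : ℝ≥0) : ℝ≥0∞) := by
    intro j
    set R := 2 ^ (j + 2) * r with hR
    have hRpos : 0 < R := by positivity
    set W := wMeasure (nu w) (Metric.ball c R) with hW
    have hW0 : W ≠ 0 := wMeasure_nu_ball_ne_zero hw.1 c hRpos
    have hWt : W ≠ ⊤ := hw.wMeasure_nu_ball_ne_top hm c hRpos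
    have hWm0 : W ^ m ≠ 0 := pow_ne_zero m hW0
    have hWmt : W ^ m ≠ ⊤ := ENNReal.pow_ne_top hWt
    have hb : (volume (Metric.ball c R))⁻¹ ^ m * ∏ i, (ballEssInf (w i) c R)⁻¹ ≤
        (W ^ m)⁻¹ * C₁ := by
      refine le_inv_mul_of_mul_le hWm0 hWmt (le_trans (le_of_eq ?_) (hC₁ c R hRpos))
      rw [ballAvg_weight, mul_pow, ← hW]
      ring
    have hd : (W ^ m)⁻¹ * (W ^ m) ^ κ = (W ^ m) ^ (κ - 1) := by
      rw [ENNReal.rpow_sub _ _ hWm0 hWmt, ENNReal.rpow_one, mul_comm, div_eq_mul_inv]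
    have he : (W ^ m) ^ (κ - 1) ≤ (ρ : ℝ≥0∞) ^ j * (V ^ m) ^ (κ - 1) := by
      have h1 : (γ : ℝ≥0∞) ^ j * V ≤ W := by
        refine le_trans ?_ (hγ c r hr (j + 2))
        gcongr
        · exact_mod_cast hγ1.le
        · omega
      have h2 : ((γ : ℝ≥0∞) ^ j * V) ^ m ≤ W ^ m := by gcongr
      have hγm0 : (γ : ℝ≥0∞) ^ m ≠ 0 := pow_ne_zero m (by exact_mod_cast hγ0)
      have hγmt : (γ : ℝ≥0∞) ^ m ≠ ⊤ := ENNReal.pow_ne_top ENNReal.coe_ne_top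
      have hρ' : (ρ : ℝ≥0∞) = ((γ : ℝ≥0∞) ^ m) ^ (κ - 1) := by
        rw [hρ, ENNReal.coe_rpow_of_ne_zero (pow_ne_zero m hγ0), ENNReal.coe_pow]
      calc (W ^ m) ^ (κ - 1) ≤ (((γ : ℝ≥0∞) ^ j * V) ^ m) ^ (κ - 1) := by
              rw [← neg_sub 1 κ, ENNReal.rpow_neg, ENNReal.rpow_neg, ENNReal.inv_le_inv]
              exact ENNReal.rpow_le_rpow h2 (by linarith)
        _ = (((γ : ℝ≥0∞) ^ m) ^ j * V ^ m) ^ (κ - 1) := by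
            rw [mul_pow, ← pow_mul, ← pow_mul, mul_comm j m]
        _ = (((γ : ℝ≥0∞) ^ m) ^ j) ^ (κ - 1) * (V ^ m) ^ (κ - 1) :=
            ENNReal.mul_rpow_of_ne_top (ENNReal.pow_ne_top hγmt) (ENNReal.pow_ne_top hVt) _
        _ = _ := by
            rw [hρ', ← ENNReal.rpow_natCast, ← ENNReal.rpow_natCast, ← ENNReal.rpow_natCast,
              ← ENNReal.rpow_natCast, ← ENNReal.rpow_mul, ← ENNReal.rpow_mul, ← ENNReal.rpow_mul,
              ← ENNReal.rpow_mul, ← ENNReal.rpow_mul]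
            congr 2
            ring
    calc _ ≤ ENNReal.ofReal (|A| / (2 ^ j * r) ^ (m * n)) *
          ∏ i, (((j + 2 : ℕ) + 1) * H i * ((ballEssInf (w i) c R)⁻¹ *
            (wMeasure (w i) (Metric.ball c R) * luxNorm (w i) (g i) c R))) := by
          gcongr with i
          exact hI j i
      _ = A' * ((j + 3 : ℝ≥0) ^ m : ℝ≥0) * P *
          (((volume (Metric.ball c R))⁻¹ ^ m * ∏ i, (ballEssInf (w i) c R)⁻¹) *
            ∏ i, (wMeasure (w i) (Metric.ball c R) * luxNorm (w i) (g i) c R)) := by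
          rw [ofReal_abs_div_eq A c hr j, ← hA', ← hR]
          rw [Finset.prod_mul_distrib, Finset.prod_mul_distrib, Finset.prod_mul_distrib,
            Finset.prod_const, Finset.card_univ, Fintype.card_fin]
          have : (((j + 2 : ℕ) : ℝ≥0∞) + 1) = (j + 3 : ℝ≥0) := by
            push_cast
            rw [add_assoc]
            norm_num
          rw [this, ENNReal.coe_pow]
          ring
      _ ≤ A' * ((j + 3 : ℝ≥0) ^ m : ℝ≥0) * P * (((W ^ m)⁻¹ * C₁) * (C₂ * (W ^ m) ^ κ * G)) := by
          gcongr
          exact hC₂ g c R hRpos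
      _ = A' * ((j + 3 : ℝ≥0) ^ m : ℝ≥0) * P * C₁ * C₂ * ((W ^ m)⁻¹ * (W ^ m) ^ κ) * G := by ring
      _ ≤ A' * ((j + 3 : ℝ≥0) ^ m : ℝ≥0) * P * C₁ * C₂ *
          ((ρ : ℝ≥0∞) ^ j * (V ^ m) ^ (κ - 1)) * G := by
          rw [hd]
          gcongr
      _ = _ := by
          rw [ENNReal.coe_mul, ENNReal.coe_pow ρ]
          ring
  calc _ ≤ ∑' j : ℕ, (A' * C₁ * C₂ * (V ^ m) ^ (κ - 1) * P * G) *
        (((j + 3 : ℝ≥0) ^ m * ρ ^ j : ℝ≥0) : ℝ≥0∞) := ENNReal.tsum_le_tsum term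
    _ = _ := by
      rw [ENNReal.tsum_mul_left, ← hS]
      ring

end FarPart

/-! ### Kernel bounds away from the ball and splitting of the extended integral. -/

section Kernel

variable {n m : ℕ}

theorem lintegral_pi_prod_eq_prod {ι : Type*} [MeasurableSpace ι] {k : ℕ}
    {μ : Fin k → Measure ι} [∀ i, SigmaFinite (μ i)] {g : Fin k → ι → ℝ≥0∞}
    (hg : ∀ i, AEMeasurable (g i) (μ i)) :
    ∫⁻ y, ∏ i, g i (y i) ∂(Measure.pi μ) = ∏ i, ∫⁻ z, g i z ∂(μ i) := by
  induction k with
  | zero => simp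
  | succ k ih =>
    have hmeas : AEMeasurable (fun y : Fin k → ι => ∏ i : Fin k, g i.succ (y i))
        (Measure.pi fun i : Fin k => μ i.succ) :=
      Finset.aemeasurable_fun_prod _ fun i _ => (hg i.succ).comp_quasiMeasurePreserving
        (Measure.quasiMeasurePreserving_eval (fun i : Fin k => μ i.succ) i)
    calc _ = ∫⁻ y : ι × (Fin k → ι), g 0 y.1 * ∏ i : Fin k, g i.succ (y.2 i)
          ∂((μ 0).prod (Measure.pi fun i : Fin k => μ i.succ)) := by
          rw [← ((measurePreserving_piFinSuccAbove μ 0).symm).lintegral_comp_emb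
            (MeasurableEquiv.measurableEmbedding _)]
          simp_rw [MeasurableEquiv.piFinSuccAbove_symm_apply, Fin.insertNthEquiv,
            Fin.prod_univ_succ, Fin.insertNth_zero, Equiv.coe_fn_mk, Fin.cons_succ,
            Fin.zero_succAbove, cast_eq, Fin.cons_zero]
      _ = _ := by
          rw [lintegral_prod_mul (hg 0) hmeas, ih fun i => hg i.succ, Fin.prod_univ_succ]

theorem setLIntegral_pi_prod_eq_prod {g : Fin m → E n → ℝ≥0∞}
    (hg : ∀ i, AEMeasurable (g i) volume) (B : Set (E n)) :
    ∫⁻ y in Set.univ.pi fun _ => B, ∏ i, g i (y i) = ∏ i, ∫⁻ z in B, g i z := by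
  rw [volume_pi, Measure.restrict_pi_pi]
  exact lintegral_pi_prod_eq_prod fun i => (hg i).restrict

theorem compl_pi_ball_subset (c : E n) (r : ℝ) (hr : 0 < r) :
    (Set.univ.pi fun _ : Fin m => Metric.ball c (2 * r))ᶜ ⊆
      ⋃ j : ℕ, ((Set.univ.pi fun _ => Metric.ball c (2 ^ (j + 2) * r)) \
        Set.univ.pi fun _ => Metric.ball c (2 ^ (j + 1) * r)) := by
  intro y hy
  have hex : ∃ j : ℕ, y ∈ Set.univ.pi fun _ : Fin m => Metric.ball c (2 ^ (j + 1) * r) := by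
    obtain ⟨j, hj⟩ := pow_unbounded_of_one_lt ((∑ i, dist (y i) c) / r) (one_lt_two (α := ℝ))
    refine ⟨j, fun i _ => ?_⟩
    rw [div_lt_iff₀ hr] at hj
    have h1 : dist (y i) c ≤ ∑ i, dist (y i) c :=
      Finset.single_le_sum (f := fun i => dist (y i) c) (fun _ _ => dist_nonneg) (Finset.mem_univ i)
    have h2 : (2 : ℝ) ^ j * r ≤ 2 ^ (j + 1) * r := by
      gcongr
      · norm_num
      · omega
    rw [Metric.mem_ball]
    linarith
  classical
  -- The shell is found from the least dilate whose power contains `y`; index 0 is excluded because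
  -- `y` lies outside `(2B)^m`.
  have hspec := Nat.find_spec hex
  rcases h : Nat.find hex with _ | j
  · rw [h] at hspec
    exact absurd (by simpa using hspec) hy
  · rw [h] at hspec
    refine Set.mem_iUnion.mpr ⟨j, hspec, ?_⟩
    exact Nat.find_min hex (by omega)

variable {X : Type*} [NormedAddCommGroup X] [NormedSpace ℂ X]

theorem IsSizeKernel.lintegral_far_le {A : ℝ} {Q : E n → (Fin m → E n) → (ℂ →L[ℂ] X)}
    (hQ : IsSizeKernel A Q) {c : E n} {r : ℝ} (hr : 0 < r) {x : E n}
    (hx : x ∈ Metric.ball c r) {g : Fin m → E n → ℝ≥0∞} (hg : ∀ i, AEMeasurable (g i) volume)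
    {F : (Fin m → E n) → ℂ} (hF : ∀ y, ‖F y‖ₑ ≤ ∏ i, g i (y i)) :
    ∫⁻ y in (Set.univ.pi fun _ : Fin m => Metric.ball c (2 * r))ᶜ, ‖Q x y (F y)‖ₑ ≤
      ∑' j : ℕ, ENNReal.ofReal (|A| / (2 ^ j * r) ^ (m * n)) *
        ∏ i, ∫⁻ z in Metric.ball c (2 ^ (j + 2) * r), g i z := by
  refine (lintegral_mono_set (compl_pi_ball_subset c r hr)).trans
    ((lintegral_iUnion_le _ _).trans (ENNReal.tsum_le_tsum fun j => ?_))
  rw [← setLIntegral_pi_prod_eq_prod hg, ← lintegral_const_mul' _ _ ENNReal.ofReal_ne_top]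
  have hms : ∀ R : ℝ, MeasurableSet (Set.univ.pi fun _ : Fin m => Metric.ball c R) :=
    fun R => MeasurableSet.univ_pi fun _ => measurableSet_ball
  refine (setLIntegral_mono' ((hms _).diff (hms _)) fun y hy => ?_).trans
    (lintegral_mono_set Set.sdiff_subset)
  obtain ⟨i, hi⟩ : ∃ i, y i ∉ Metric.ball c (2 ^ (j + 1) * r) := by
    by_contra! h
    exact hy.2 fun i _ => h i
  rw [Metric.mem_ball, not_lt] at hi
  rw [Metric.mem_ball] at hx
  have h1 : (1 : ℝ) ≤ 2 ^ j := one_le_pow₀ one_le_two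
  -- Some `y i` has distance at least `2^{j+1} r` from `c`, and `x` has distance less than `r`; at
  -- least `2^j r` remains.
  have hdist : 2 ^ j * r ≤ ‖x - y i‖ := by
    have h2 := dist_triangle_left (y i) c x
    rw [dist_eq_norm x (y i)] at h2
    have h3 : (2 : ℝ) ^ (j + 1) * r = 2 ^ j * r + 2 ^ j * r := by ring
    nlinarith
  have hpos : 0 < 2 ^ j * r := by positivity
  have hne : y i ≠ x := by
    rintro h
    rw [h, sub_self, norm_zero] at hdist
    linarith
  have hsum : 2 ^ j * r ≤ ∑ i, ‖x - y i‖ := hdist.trans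
    (Finset.single_le_sum (f := fun i => ‖x - y i‖) (fun _ _ => norm_nonneg _)
      (Finset.mem_univ i))
  have hnorm : ‖Q x y‖ ≤ |A| / (2 ^ j * r) ^ (m * n) := by
    refine (hQ.size x y ⟨i, hne⟩).trans ?_
    gcongr
    exact le_abs_self A
  calc ‖Q x y (F y)‖ₑ ≤ ‖Q x y‖ₑ * ‖F y‖ₑ := (Q x y).le_opENorm _
    _ ≤ _ := by
      gcongr
      · rw [← ofReal_norm]
        exact ENNReal.ofReal_le_ofReal hnorm
      · exact hF y

/-- If the tail integral is infinite, or the truncated function has no value, the right side is `⊤`.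
Otherwise the tail lies in the domain of the absolutely convergent integral, where `J x` must agree
with it, and linearity gives the value at `F`. -/
theorem valueNorm_le_add_lintegral {Q : E n → (Fin m → E n) → (ℂ →L[ℂ] X)}
    {J : E n → ((Fin m → E n) → ℂ) →ₗ.[ℂ] X} (hJ : IsIntegralExtension Q J) (x : E n)
    {F : (Fin m → E n) → ℂ} (hF : AEStronglyMeasurable (fun y => Q x y (F y)) volume)
    {D : Set (Fin m → E n)} (hD : MeasurableSet D) :
    valueNorm (J x) F ≤ valueNorm (J x) (D.indicator F) + ∫⁻ y in Dᶜ, ‖Q x y (F y)‖ₑ := by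
  by_cases hfin : ∫⁻ y in Dᶜ, ‖Q x y (F y)‖ₑ = ⊤
  · rw [hfin, add_top]
    exact le_top
  by_cases hdom : D.indicator F ∈ (J x).domain
  · have hind : (fun y => Q x y (Dᶜ.indicator F y)) = Dᶜ.indicator fun y => Q x y (F y) := by
      funext y
      by_cases hy : y ∈ Dᶜ <;> simp [hy]
    have hcdom : Dᶜ.indicator F ∈ (kernelIntegral Q x).domain := by
      change Integrable (fun y => Q x y (Dᶜ.indicator F y)) volume
      rw [hind, integrable_indicator_iff hD.compl]
      exact ⟨hF.restrict, lt_top_iff_ne_top.mpr hfin⟩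
    have hcdom' : Dᶜ.indicator F ∈ (J x).domain := (hJ x).1 hcdom
    have hval : J x ⟨Dᶜ.indicator F, hcdom'⟩ = ∫ y in Dᶜ, Q x y (F y) := by
      rw [← (hJ x).2 (x := ⟨Dᶜ.indicator F, hcdom⟩) (y := ⟨Dᶜ.indicator F, hcdom'⟩) rfl]
      change ∫ y, Q x y (Dᶜ.indicator F y) = _
      rw [hind, integral_indicator hD.compl]
    have hsum : D.indicator F + Dᶜ.indicator F = F := Set.indicator_self_add_compl D F
    have hFdom : F ∈ (J x).domain := by
      rw [← hsum]
      exact (J x).domain.add_mem hdom hcdom'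
    have hJF : J x ⟨F, hFdom⟩ = J x ⟨D.indicator F, hdom⟩ + J x ⟨Dᶜ.indicator F, hcdom'⟩ := by
      rw [← LinearPMap.map_add]
      congr 1
      exact Subtype.ext hsum.symm
    unfold valueNorm
    rw [dif_pos hFdom, dif_pos hdom, hJF, hval]
    exact (enorm_add_le _ _).trans (by gcongr; exact enorm_integral_le_lintegral_enorm _)
  · have : valueNorm (J x) (D.indicator F) = ⊤ := by
      unfold valueNorm
      rw [dif_neg hdom]
    rw [this, top_add]
    exact le_top

theorem IsSizeKernel.aestronglyMeasurable_apply {A : ℝ}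
    {Q : E n → (Fin m → E n) → (ℂ →L[ℂ] X)} (hQ : IsSizeKernel A Q) (x : E n)
    {F : (Fin m → E n) → ℂ} (hF : AEStronglyMeasurable F volume) :
    AEStronglyMeasurable (fun y => Q x y (F y)) volume := by
  have h : (fun y => Q x y (F y)) = fun y => F y • Q x y 1 := by
    funext y
    rw [← map_smul, smul_eq_mul, mul_one]
  rw [h]
  exact hF.smul ((hQ.measurable x).apply_continuousLinearMap 1)

theorem aestronglyMeasurable_comp_eval {f : E n → ℂ} (hf : AEStronglyMeasurable f volume)
    (i : Fin m) : AEStronglyMeasurable (fun y : Fin m → E n => f (y i)) volume :=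
  hf.comp_quasiMeasurePreserving (Measure.quasiMeasurePreserving_eval (fun _ => volume) i)

theorem prod_indicator_eq (B : Set (E n)) (f : Fin m → E n → ℂ) (y : Fin m → E n) :
    ∏ i, B.indicator (f i) (y i) =
      (Set.univ.pi fun _ => B).indicator (fun y => ∏ i, f i (y i)) y := by
  by_cases hy : y ∈ Set.univ.pi fun _ : Fin m => B
  · rw [Set.indicator_of_mem hy]
    exact Finset.prod_congr rfl fun i _ => Set.indicator_of_mem (hy i trivial) _
  · rw [Set.indicator_of_notMem hy]
    obtain ⟨i, hi⟩ : ∃ i, y i ∉ B := by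
      by_contra! h
      exact hy fun i _ => h i
    exact Finset.prod_eq_zero (Finset.mem_univ i) (Set.indicator_of_notMem hi _)

end Kernel

end MorreyLLogL

namespace MorreyLLogL

/-! ### Local and far estimates, and level sets. -/

section WeakType

variable {n m : ℕ}

theorem IsMultiA1.ballEssInf_ne_zero {w : Fin m → E n → ℝ} (hw : IsMultiA1 w) (hm : m ≠ 0)
    (i : Fin m) (c : E n) {r : ℝ} (hr : 0 < r) : ballEssInf (w i) c r ≠ 0 := by
  obtain ⟨C, -, hC⟩ := hw.exists_ballAvg_pow_le
  intro h
  have h1 := hC c r hr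
  rw [Finset.prod_eq_zero (Finset.mem_univ i) h, mul_zero, nonpos_iff_eq_zero,
    pow_eq_zero_iff hm, ballAvg_weight] at h1
  rcases mul_eq_zero.mp h1 with h2 | h2
  · exact volume_ball_ne_top c r (ENNReal.inv_eq_zero.mp h2)
  · exact wMeasure_nu_ball_ne_zero hw.1 c hr h2

/-- The local part. Passing from `l` to `l / 2` costs the doubling constant of the iterated Young
function, and passing from `2B` to `B` costs that of `ν`. -/
theorem exists_prod_lintegral_indicator_le (hm : m ≠ 0) {κ : ℝ} (hκ0 : 0 ≤ κ)
    {w : Fin m → E n → ℝ} (hw : IsMultiA1 w) (hw' : ∀ i, IsAInfty (w i)) (k : ℕ) :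
    ∃ C : ℝ≥0, ∀ (f : Fin m → E n → ℂ) (l : ℝ), 0 < l → ∀ (c : E n) (r : ℝ), 0 < r →
      ∏ i, ∫⁻ x, ENNReal.ofReal (Phi^[k] (‖(Metric.ball c (2 * r)).indicator (f i) x‖ / (l / 2)))
        ∂(wMeasure (w i)) ≤
      C * (wMeasure (nu w) (Metric.ball c r) ^ m) ^ κ *
        ∏ i, morreyLLogL κ (w i) fun x => Phi^[k] (‖f i x‖ / l) := by
  obtain ⟨D, hD1, hD⟩ := exists_iterate_Phi_mul_two_le k
  obtain ⟨C₂, hC₂⟩ := exists_prod_luxNorm_le hm hκ0 hw.1 hw'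
  obtain ⟨C₃, -, hC₃⟩ := hw.exists_ballComparable hm
  refine ⟨(ENNReal.ofReal D ^ m * C₂ * ((C₃ * ENNReal.ofReal (2 ^ n)) ^ m) ^ κ).toNNReal,
    fun f l hl c r hr => ?_⟩
  rw [ENNReal.coe_toNNReal (by
    refine ENNReal.mul_ne_top (by finiteness) (ENNReal.rpow_ne_top_of_nonneg hκ0 (by finiteness)))]
  set G := ∏ i, morreyLLogL κ (w i) fun x => Phi^[k] (‖f i x‖ / l)
  have h1 : ∀ i, ∫⁻ x, ENNReal.ofReal
      (Phi^[k] (‖(Metric.ball c (2 * r)).indicator (f i) x‖ / (l / 2))) ∂(wMeasure (w i)) ≤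
      ENNReal.ofReal D * (wMeasure (w i) (Metric.ball c (2 * r)) *
        luxNorm (w i) (fun x => Phi^[k] (‖f i x‖ / l)) c (2 * r)) := by
    intro i
    calc _ ≤ ∫⁻ x, (Metric.ball c (2 * r)).indicator (fun x =>
          ENNReal.ofReal D * ENNReal.ofReal (Phi^[k] (‖f i x‖ / l))) x ∂(wMeasure (w i)) := by
          refine lintegral_mono fun x => ?_
          by_cases hx : x ∈ Metric.ball c (2 * r)
          · rw [Set.indicator_of_mem hx, Set.indicator_of_mem hx,
              ← ENNReal.ofReal_mul (by linarith)]
            refine ENNReal.ofReal_le_ofReal ?_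
            rw [show ‖f i x‖ / (l / 2) = 2 * (‖f i x‖ / l) by field_simp]
            exact hD _ (by positivity)
          · rw [Set.indicator_of_notMem hx, Set.indicator_of_notMem hx, norm_zero, zero_div,
              iterate_Phi_zero, ENNReal.ofReal_zero]
      _ = ENNReal.ofReal D * ∫⁻ x in Metric.ball c (2 * r),
          ENNReal.ofReal (Phi^[k] (‖f i x‖ / l)) ∂(wMeasure (w i)) := by
          rw [lintegral_indicator measurableSet_ball,
            lintegral_const_mul' _ _ ENNReal.ofReal_ne_top]
      _ ≤ _ := by
          gcongr
          exact (hw.1 i).lintegral_le_mul_luxNorm _ c (by positivity)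
  calc _ ≤ ∏ i, (ENNReal.ofReal D * (wMeasure (w i) (Metric.ball c (2 * r)) *
        luxNorm (w i) (fun x => Phi^[k] (‖f i x‖ / l)) c (2 * r))) :=
        Finset.prod_le_prod' fun i _ => h1 i
    _ = ENNReal.ofReal D ^ m * ∏ i, (wMeasure (w i) (Metric.ball c (2 * r)) *
        luxNorm (w i) (fun x => Phi^[k] (‖f i x‖ / l)) c (2 * r)) := by
        rw [Finset.prod_mul_distrib, Finset.prod_const, Finset.card_univ, Fintype.card_fin]
    _ ≤ ENNReal.ofReal D ^ m * (C₂ * (wMeasure (nu w) (Metric.ball c (2 * r)) ^ m) ^ κ * G) := by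
        gcongr
        exact hC₂ (fun i x => Phi^[k] (‖f i x‖ / l)) c (2 * r) (by positivity)
    _ ≤ ENNReal.ofReal D ^ m * (C₂ * ((C₃ * ENNReal.ofReal (2 ^ n) *
        wMeasure (nu w) (Metric.ball c r)) ^ m) ^ κ * G) := by
        gcongr
        exact hC₃.measure_ball_mul_le c hr one_le_two
    _ = _ := by
        rw [mul_pow, ENNReal.mul_rpow_of_nonneg _ _ hκ0]
        ring

/-- `T` is the set of indices that carry a symbol: a singleton for the summands of the commutator,
everything for the iterated one. -/
theorem exists_lintegral_far_le (hn : n ≠ 0) (hm : m ≠ 0) {κ : ℝ} (hκ0 : 0 < κ) (hκ1 : κ < 1)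
    {w : Fin m → E n → ℝ} (hw : IsMultiA1 w) (hw' : ∀ i, IsAInfty (w i)) (A : ℝ) :
    ∃ C : ℝ≥0, ∀ (X : Type*) [NormedAddCommGroup X] [NormedSpace ℂ X]
      (Q : E n → (Fin m → E n) → (ℂ →L[ℂ] X)), IsSizeKernel A Q →
      ∀ (b : Fin m → E n → ℂ), (∀ i, LocallyIntegrable (b i) volume) →
      ∀ M : ℝ≥0, 0 < M → (∀ i, bmoNorm (b i) ≤ M) →
      ∀ (f : Fin m → E n → ℂ), (∀ i, AEStronglyMeasurable (f i) volume) →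
      ∀ (l : ℝ), 0 < l → ∀ (k : ℕ) (c : E n) (r : ℝ), 0 < r → ∀ x ∈ Metric.ball c r,
      ∀ (T : Finset (Fin m)) (F : (Fin m → E n) → ℂ),
      (∀ y, ‖F y‖ₑ ≤ ∏ i, ((if i ∈ T then ‖b i x - b i (y i)‖ₑ else 1) * ‖f i (y i)‖ₑ)) →
      ∫⁻ y in (Set.univ.pi fun _ : Fin m => Metric.ball c (2 * r))ᶜ, ‖Q x y (F y)‖ₑ ≤
        C * (wMeasure (nu w) (Metric.ball c r) ^ m) ^ (κ - 1) *
          (∏ i, morreyLLogL κ (w i) fun x => Phi^[k] (‖f i x‖ / l)) *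
          (ENNReal.ofReal l ^ m *
            ∏ i, if i ∈ T then ‖b i x - ⨍ y in Metric.ball c r, b i y‖ₑ + M else 1) := by
  obtain ⟨C₁, hC₁⟩ := exists_tsum_far_le hn hm hκ0 hκ1 hw hw' A
  obtain ⟨C₂, hC₂1, hC₂⟩ := exists_lintegral_sub_mul_le n
  refine ⟨C₁ * C₂ ^ m, ?_⟩
  intro X _ _ Q hQ b hb M hM hbM f hf l hl k c r hr x hx T F hF
  have hg : ∀ i, AEMeasurable
      (fun z => (if i ∈ T then ‖b i x - b i z‖ₑ else 1) * ‖f i z‖ₑ) volume := by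
    intro i
    refine AEMeasurable.mul ?_ (hf i).enorm
    by_cases hi : i ∈ T
    · simp only [hi, if_true]
      exact (aestronglyMeasurable_const.sub (hb i).aestronglyMeasurable).enorm
    · simp only [hi, if_false]
      exact aemeasurable_const
  refine (hQ.lintegral_far_le hr hx hg hF).trans ?_
  set φ : Fin m → E n → ℝ := fun i z => Phi^[k] (‖f i z‖ / l) with hφ
  have hφm : ∀ i, AEMeasurable (φ i) volume := fun i =>
    (measurable_iterate_Phi k).comp_aemeasurable ((hf i).norm.aemeasurable.div_const l)
  have hfφ : ∀ i z, ‖f i z‖ₑ ≤ ENNReal.ofReal l * ENNReal.ofReal (φ i z) := by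
    intro i z
    rw [← ENNReal.ofReal_mul hl.le, ← ofReal_norm]
    refine ENNReal.ofReal_le_ofReal ?_
    calc ‖f i z‖ = l * (‖f i z‖ / l) := by field_simp
      _ ≤ _ := by
        gcongr
        exact le_iterate_Phi k (by positivity)
  have hI := hC₁ φ c r hr
    (fun j i => ∫⁻ z in Metric.ball c (2 ^ (j + 2) * r),
      (if i ∈ T then ‖b i x - b i z‖ₑ else 1) * ‖f i z‖ₑ)
    (fun i => ENNReal.ofReal l * (C₂ *
      (if i ∈ T then ‖b i x - ⨍ y in Metric.ball c r, b i y‖ₑ + M else 1))) ?_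
  · refine hI.trans (le_of_eq ?_)
    rw [Finset.prod_mul_distrib, Finset.prod_mul_distrib, Finset.prod_const, Finset.prod_const,
      Finset.card_univ, Fintype.card_fin]
    push_cast
    ring
  · intro j i
    have hR : 0 < 2 ^ (j + 2) * r := by positivity
    have he := hw.ballEssInf_ne_zero hm i c hR
    set Y := (ballEssInf (w i) c (2 ^ (j + 2) * r))⁻¹ *
      (wMeasure (w i) (Metric.ball c (2 ^ (j + 2) * r)) *
        luxNorm (w i) (φ i) c (2 ^ (j + 2) * r)) with hY
    have h1 : ∫⁻ z in Metric.ball c (2 ^ (j + 2) * r),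
        (if i ∈ T then ‖b i x - b i z‖ₑ else 1) * ‖f i z‖ₑ ≤
        ENNReal.ofReal l * ∫⁻ z in Metric.ball c (2 ^ (j + 2) * r),
          (if i ∈ T then ‖b i x - b i z‖ₑ else 1) * ENNReal.ofReal (φ i z) := by
      rw [← lintegral_const_mul' _ _ ENNReal.ofReal_ne_top]
      refine lintegral_mono fun z => ?_
      rw [mul_left_comm]
      exact mul_le_mul_right (hfφ i z) _
    refine h1.trans ?_
    by_cases hi : i ∈ T
    · simp only [hi, if_true]
      calc _ ≤ ENNReal.ofReal l * (((j + 2 : ℕ) + 1) *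
            (C₂ * (‖b i x - ⨍ y in Metric.ball c r, b i y‖ₑ + M)) * Y) := by
            gcongr
            exact hC₂ (b i) (hb i) M hM (hbM i) (w i) (hw.1 i) (φ i) (hφm i) c r hr (j + 2) he x
        _ = _ := by ring
    · simp only [hi, if_false, one_mul]
      calc _ ≤ ENNReal.ofReal l * (1 * 1 * Y) := by
            rw [one_mul, one_mul]
            gcongr
            exact (hw.1 i).lintegral_volume_le_mul_luxNorm (hφm i) c hR he
        -- An index without symbol needs no growth factor; it is enlarged to fit the common form
        -- required of all indices.
        _ ≤ ENNReal.ofReal l * (((j + 2 : ℕ) + 1) * C₂ * Y) := by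
            gcongr
            · exact le_add_self
            · exact_mod_cast hC₂1
        _ = _ := by ring

/-- Functions of bounded mean oscillation have bounded mean oscillation with respect to measures
of class `A₁`. -/
theorem exists_lintegral_sub_average_add_le {μ : Measure (E n)} (hac : μ ≪ volume) {C : ℝ≥0}
    (hμ : BallComparable μ C) (hfin : ∀ (c : E n) (r : ℝ), 0 < r → μ (Metric.ball c r) ≠ ⊤) :
    ∃ K : ℝ≥0, ∀ (b : E n → ℂ), LocallyIntegrable b volume →
      ∀ M : ℝ≥0, 0 < M → bmoNorm b ≤ M → ∀ (c : E n) (r : ℝ), 0 < r →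
        ∫⁻ x in Metric.ball c r, (‖b x - ⨍ y in Metric.ball c r, b y‖ₑ + M) ∂μ ≤
          K * M * μ (Metric.ball c r) := by
  obtain ⟨a, ha, Λ, hΛ⟩ := exists_john_nirenberg hac hμ hfin
  refine ⟨a⁻¹.toNNReal * Λ + 1, fun b hb M hM hbM c r hr => ?_⟩
  -- Exponential integrability yields the first moment through `t ≤ e^t`.
  have hpt : ∀ z : ℂ, ‖z‖ₑ ≤ ENNReal.ofReal a⁻¹ * M * expNorm (a / M) z := by
    intro z
    have hM' : (0 : ℝ) < M := hM
    have h2 : (M : ℝ≥0∞) = ENNReal.ofReal M := by simp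
    rw [h2, expNorm, ← ENNReal.ofReal_mul (by positivity), ← ENNReal.ofReal_mul (by positivity),
      ← ofReal_norm]
    refine ENNReal.ofReal_le_ofReal ?_
    calc ‖z‖ = a⁻¹ * M * (a / M * ‖z‖) := by field_simp
      _ ≤ _ := by
        gcongr
        linarith [Real.add_one_le_exp (a / M * ‖z‖)]
  rw [lintegral_add_right _ measurable_const, setLIntegral_const]
  calc _ ≤ (∫⁻ x in Metric.ball c r, ENNReal.ofReal a⁻¹ * M *
        expNorm (a / M) (b x - ⨍ y in Metric.ball c r, b y) ∂μ) + M * μ (Metric.ball c r) := by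
        gcongr
        exact hpt _
    _ = ENNReal.ofReal a⁻¹ * M * (∫⁻ x in Metric.ball c r,
        expNorm (a / M) (b x - ⨍ y in Metric.ball c r, b y) ∂μ) + M * μ (Metric.ball c r) := by
        rw [lintegral_const_mul' _ _ (by finiteness)]
    _ ≤ ENNReal.ofReal a⁻¹ * M * (Λ * μ (Metric.ball c r)) + M * μ (Metric.ball c r) := by
        gcongr
        exact hΛ b hb M hM hbM c r hr
    _ = _ := by
        rw [ENNReal.ofReal]
        push_cast
        ring

theorem add_pow_le_two_pow_mul (a b : ℝ≥0∞) (m : ℕ) :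
    (a + b) ^ m ≤ 2 ^ m * (a ^ m + b ^ m) := by
  rcases le_total a b with h | h
  · calc (a + b) ^ m ≤ (b + b) ^ m := by gcongr
      _ = 2 ^ m * b ^ m := by rw [← two_mul, mul_pow]
      _ ≤ _ := by gcongr; exact le_add_self
  · calc (a + b) ^ m ≤ (a + a) ^ m := by gcongr
      _ = 2 ^ m * a ^ m := by rw [← two_mul, mul_pow]
      _ ≤ _ := by gcongr; exact le_self_add

/-- The level set of a sum of two functions, in the normalization of the Morrey estimate. -/
theorem rpow_mul_measure_pow_le {μ : Measure (E n)} (hm : m ≠ 0) {κ : ℝ} {c : E n} {r : ℝ}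
    (h0 : μ (Metric.ball c r) ≠ 0) (ht : μ (Metric.ball c r) ≠ ⊤) {S S₀ R : E n → ℝ≥0∞}
    (hS : ∀ x ∈ Metric.ball c r, S x ≤ S₀ x + R x) {l : ℝ} (hl : 0 < l) {K₁ K₂ G : ℝ≥0∞}
    (h1 : μ {x | ENNReal.ofReal ((l / 2) ^ m) < S₀ x} ^ m ≤
      K₁ * (μ (Metric.ball c r) ^ m) ^ κ * G)
    (h2 : μ {x | x ∈ Metric.ball c r ∧ ENNReal.ofReal ((l / 2) ^ m) < R x} ^ m ≤
      K₂ * (μ (Metric.ball c r) ^ m) ^ κ * G) :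
    μ (Metric.ball c r) ^ (-((m : ℝ) * κ)) *
      μ {x | x ∈ Metric.ball c r ∧ ENNReal.ofReal (l ^ m) < S x} ^ m ≤
      2 ^ m * (K₁ + K₂) * G := by
  have hhalf : ENNReal.ofReal ((l / 2) ^ m) + ENNReal.ofReal ((l / 2) ^ m) ≤
      ENNReal.ofReal (l ^ m) := by
    rw [← ENNReal.ofReal_add (by positivity) (by positivity)]
    refine ENNReal.ofReal_le_ofReal ?_
    have h3 := pow_add_pow_le (by positivity : 0 ≤ l / 2) (by positivity : 0 ≤ l / 2) hm
    rwa [add_halves] at h3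
  have hsub : {x | x ∈ Metric.ball c r ∧ ENNReal.ofReal (l ^ m) < S x} ⊆
      {x | ENNReal.ofReal ((l / 2) ^ m) < S₀ x} ∪
        {x | x ∈ Metric.ball c r ∧ ENNReal.ofReal ((l / 2) ^ m) < R x} := by
    rintro x ⟨hx, hlt⟩
    by_contra hcon
    simp only [Set.mem_union, Set.mem_ofPred_eq, not_or, not_and, not_lt] at hcon
    have := hlt.trans_le ((hS x hx).trans ((add_le_add hcon.1 (hcon.2 hx)).trans hhalf))
    exact lt_irrefl _ this
  have hV : μ (Metric.ball c r) ^ (-((m : ℝ) * κ)) * (μ (Metric.ball c r) ^ m) ^ κ = 1 := by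
    rw [← ENNReal.rpow_natCast, ← ENNReal.rpow_mul, ← ENNReal.rpow_add _ _ h0 ht,
      neg_add_cancel, ENNReal.rpow_zero]
  calc _ ≤ μ (Metric.ball c r) ^ (-((m : ℝ) * κ)) *
        (2 ^ m * (K₁ * (μ (Metric.ball c r) ^ m) ^ κ * G +
          K₂ * (μ (Metric.ball c r) ^ m) ^ κ * G)) := by
        gcongr
        exact (pow_le_pow_left' ((measure_mono hsub).trans (measure_union_le _ _)) m).trans
          ((add_pow_le_two_pow_mul _ _ m).trans (by gcongr))
    _ = μ (Metric.ball c r) ^ (-((m : ℝ) * κ)) * (μ (Metric.ball c r) ^ m) ^ κ *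
        (2 ^ m * (K₁ + K₂) * G) := by ring
    _ = _ := by rw [hV, one_mul]

theorem one_le_of_lt_mul {t K Z : ℝ≥0∞} (h : t < K * (t * Z)) : 1 ≤ K * Z := by
  by_contra! hlt
  have : K * (t * Z) ≤ t := by
    calc K * (t * Z) = t * (K * Z) := by ring
      _ ≤ t * 1 := by gcongr
      _ = t := mul_one t
  exact absurd (h.trans_le this) (lt_irrefl _)

theorem ofReal_pow_eq_two_pow_mul {l : ℝ} (hl : 0 < l) (m : ℕ) :
    ENNReal.ofReal l ^ m = 2 ^ m * ENNReal.ofReal ((l / 2) ^ m) := by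
  have : (2 : ℝ≥0∞) = ENNReal.ofReal 2 := by simp
  rw [this, ← ENNReal.ofReal_pow hl.le, ← ENNReal.ofReal_pow two_pos.le,
    ← ENNReal.ofReal_mul (by positivity), ← mul_pow]
  congr 2
  ring

/-- Chebyshev's inequality for a level set that need not be measurable, since nothing is known about
the measurability of the commutators. -/
theorem measure_le_lintegral_of_one_le {μ : Measure (E n)} {B : Set (E n)} {P : E n → Prop}
    {Z : E n → ℝ≥0∞} (hZ : AEMeasurable Z (μ.restrict B)) (h : ∀ x ∈ B, P x → 1 ≤ Z x) :
    μ {x | x ∈ B ∧ P x} ≤ ∫⁻ x in B, Z x ∂μ := by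
  have h1 : {x | x ∈ B ∧ P x} ⊆ {x | 1 ≤ Z x} ∩ B := fun x hx => ⟨h x hx.1 hx.2, hx.1⟩
  calc _ ≤ μ ({x | 1 ≤ Z x} ∩ B) := measure_mono h1
    _ ≤ μ.restrict B {x | 1 ≤ Z x} := Measure.le_restrict_apply _ _
    _ ≤ _ := by simpa using mul_meas_ge_le_lintegral₀ hZ 1

/-- Chebyshev is applied to one factor of the `m`-th power, and the other `m - 1` are bounded by `μ
B`. Hence `D`, which will carry the Morrey norms and the symbol-free power of `ν(B)`, enters
linearly. -/
theorem measure_pow_le_of_sum {μ : Measure (E n)} (hm : m ≠ 0) {B : Set (E n)}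
    {Z : Fin m → E n → ℝ≥0∞} (hZ : ∀ i, AEMeasurable (Z i) (μ.restrict B)) {K : ℝ≥0∞}
    (hK : ∀ i, ∫⁻ x in B, Z i x ∂μ ≤ K * μ B) {D : ℝ≥0∞} {l : ℝ} (hl : 0 < l)
    {R : E n → ℝ≥0∞} (hR : ∀ x ∈ B, R x ≤ D * (ENNReal.ofReal l ^ m * ∑ i, Z i x)) :
    μ {x | x ∈ B ∧ ENNReal.ofReal ((l / 2) ^ m) < R x} ^ m ≤ 2 ^ m * D * (m * K) * μ B ^ m := by
  have h1 : μ {x | x ∈ B ∧ ENNReal.ofReal ((l / 2) ^ m) < R x} ≤ 2 ^ m * D * (m * K) * μ B := by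
    refine (measure_le_lintegral_of_one_le (Z := fun x => 2 ^ m * D * ∑ i, Z i x)
      ((Finset.aemeasurable_fun_sum _ fun i _ => hZ i).const_mul _) fun x hx hlt => ?_).trans ?_
    · refine one_le_of_lt_mul (t := ENNReal.ofReal ((l / 2) ^ m))
        (hlt.trans_le ((hR x hx).trans (le_of_eq ?_)))
      rw [ofReal_pow_eq_two_pow_mul hl]
      ring
    · rw [lintegral_const_mul'' _ (Finset.aemeasurable_fun_sum _ fun i _ => hZ i),
        lintegral_finsetSum' _ fun i _ => hZ i]
      calc _ ≤ 2 ^ m * D * ∑ _i : Fin m, K * μ B := by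
            gcongr with i
            exact hK i
        _ = _ := by
            rw [Finset.sum_const, Finset.card_univ, Fintype.card_fin, nsmul_eq_mul]
            ring
  obtain ⟨p, rfl⟩ : ∃ p, m = p + 1 := ⟨m - 1, by omega⟩
  rw [pow_succ (μ {x | x ∈ B ∧ ENNReal.ofReal ((l / 2) ^ (p + 1)) < R x}) p, pow_succ (μ B) p]
  calc _ ≤ μ B ^ p * (2 ^ (p + 1) * D * ((p + 1 : ℕ) * K) * μ B) := by
        gcongr
        exact fun x hx => hx.1
    _ = _ := by ring

/-- First moments of the `Z i` do not control that of their product. Chebyshev is therefore applied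
to its `m`-th root, where Hölder with all exponents `1/m` needs only these moments; raising to the
power `m` makes `D` linear again. -/
theorem measure_pow_le_of_prod {μ : Measure (E n)} (hm : m ≠ 0) {B : Set (E n)}
    {Z : Fin m → E n → ℝ≥0∞} (hZ : ∀ i, AEMeasurable (Z i) (μ.restrict B)) {K : ℝ≥0∞}
    (hK : ∀ i, ∫⁻ x in B, Z i x ∂μ ≤ K * μ B) {D : ℝ≥0∞} {l : ℝ} (hl : 0 < l)
    {R : E n → ℝ≥0∞} (hR : ∀ x ∈ B, R x ≤ D * (ENNReal.ofReal l ^ m * ∏ i, Z i x)) :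
    μ {x | x ∈ B ∧ ENNReal.ofReal ((l / 2) ^ m) < R x} ^ m ≤ 2 ^ m * D * K ^ m * μ B ^ m := by
  have hm' : (m : ℝ) ≠ 0 := by exact_mod_cast hm
  have hmeas : AEMeasurable (fun x => ∏ i, Z i x ^ (1 / (m : ℝ))) (μ.restrict B) :=
    Finset.aemeasurable_fun_prod _ fun i _ => (hZ i).pow_const _
  have hroot : ∀ a : ℝ≥0∞, (a ^ (1 / (m : ℝ))) ^ m = a := by
    intro a
    rw [← ENNReal.rpow_natCast, ← ENNReal.rpow_mul, one_div, inv_mul_cancel₀ hm',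
      ENNReal.rpow_one]
  have h1 : μ {x | x ∈ B ∧ ENNReal.ofReal ((l / 2) ^ m) < R x} ≤
      (2 ^ m * D) ^ (1 / (m : ℝ)) * (∏ _i : Fin m, (K * μ B) ^ (1 / (m : ℝ))) := by
    refine (measure_le_lintegral_of_one_le
      (Z := fun x => (2 ^ m * D) ^ (1 / (m : ℝ)) * ∏ i, Z i x ^ (1 / (m : ℝ)))
      (hmeas.const_mul _) fun x hx hlt => ?_).trans ?_
    · rw [ENNReal.prod_rpow_of_nonneg (by positivity),
        ← ENNReal.mul_rpow_of_nonneg _ _ (by positivity)]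
      refine ENNReal.one_le_rpow ?_ (by positivity)
      refine one_le_of_lt_mul (t := ENNReal.ofReal ((l / 2) ^ m))
        (hlt.trans_le ((hR x hx).trans (le_of_eq ?_)))
      rw [ofReal_pow_eq_two_pow_mul hl]
      ring
    · rw [lintegral_const_mul'' _ hmeas]
      gcongr
      refine (ENNReal.lintegral_prod_norm_pow_le Finset.univ (fun i _ => hZ i)
        (p := fun _ => 1 / (m : ℝ)) (by simp [hm']) fun _ _ => by positivity).trans ?_
      gcongr with i
      exact hK i
  calc _ ≤ ((2 ^ m * D) ^ (1 / (m : ℝ)) * (∏ _i : Fin m, (K * μ B) ^ (1 / (m : ℝ)))) ^ m := by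
        gcongr
    _ = 2 ^ m * D * K ^ m * μ B ^ m := by
        rw [Finset.prod_const, Finset.card_univ, Fintype.card_fin, hroot, mul_pow, hroot]
        ring

end WeakType

end MorreyLLogL

namespace MorreyLLogL

/-! ### The two commutators as instances of the splitting. -/

section Commutators

variable {n m : ℕ}

theorem bmoNorm_le_toNNReal_bmoNormVec {b : Fin m → E n → ℂ} (hb : ∀ N, IsBMO (b N))
    (N : Fin m) : bmoNorm (b N) ≤ (bmoNormVec b).toNNReal := by
  have hfin : ⨆ N, bmoNorm (b N) ≠ ⊤ := by
    refine (iSup_lt_iff.mpr ?_).ne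
    refine ⟨Finset.univ.sup fun N => bmoNorm (b N), ?_,
      fun N => Finset.le_sup (f := fun N => bmoNorm (b N)) (Finset.mem_univ N)⟩
    rw [Finset.sup_lt_iff (by simp)]
    exact fun N _ => (hb N).2
  change _ ≤ ENNReal.ofReal (⨆ N, bmoNorm (b N)).toReal
  rw [ENNReal.ofReal_toReal hfin]
  exact le_iSup (fun N => bmoNorm (b N)) N

theorem aestronglyMeasurable_indicator {f : E n → ℂ} (hf : AEStronglyMeasurable f volume)
    (c : E n) (r : ℝ) : AEStronglyMeasurable ((Metric.ball c r).indicator f) volume :=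
  hf.indicator measurableSet_ball

variable {X : Type*} [NormedAddCommGroup X] [NormedSpace ℂ X]

/-- Truncating every `f i` to the ball is the same as truncating the integrand to the power of the
ball; the difference of symbols is unaffected. -/
theorem commN_le {A : ℝ} {Q : E n → (Fin m → E n) → (ℂ →L[ℂ] X)} (hQ : IsSizeKernel A Q)
    {J : E n → ((Fin m → E n) → ℂ) →ₗ.[ℂ] X} (hJ : IsIntegralExtension Q J)
    {b : Fin m → E n → ℂ} (hb : ∀ N, IsBMO (b N)) {f : Fin m → E n → ℂ}
    (hf : ∀ i, AEStronglyMeasurable (f i) volume) (N : Fin m) (c : E n) (r : ℝ) (x : E n) :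
    commN J b N f x ≤ commN J b N (fun i => (Metric.ball c r).indicator (f i)) x +
      ∫⁻ y in (Set.univ.pi fun _ : Fin m => Metric.ball c r)ᶜ,
        ‖Q x y ((b N x - b N (y N)) * ∏ j, f j (y j))‖ₑ := by
  have hF : AEStronglyMeasurable (fun y : Fin m → E n =>
      (b N x - b N (y N)) * ∏ j, f j (y j)) volume :=
    (aestronglyMeasurable_const.sub
      (aestronglyMeasurable_comp_eval (hb N).1.aestronglyMeasurable N)).mul
      (Finset.aestronglyMeasurable_fun_prod _ fun j _ => aestronglyMeasurable_comp_eval (hf j) j)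
  have h := valueNorm_le_add_lintegral hJ x (hQ.aestronglyMeasurable_apply x hF)
    (MeasurableSet.univ_pi fun _ : Fin m => measurableSet_ball (x := c) (ε := r))
  refine h.trans (le_of_eq ?_)
  congr 1
  unfold commN
  congr 1
  funext y
  rw [prod_indicator_eq]
  by_cases hy : y ∈ Set.univ.pi fun _ : Fin m => Metric.ball c r
  · rw [Set.indicator_of_mem hy, Set.indicator_of_mem hy]
  · rw [Set.indicator_of_notMem hy, Set.indicator_of_notMem hy, mul_zero]

theorem iterComm_le {A : ℝ} {Q : E n → (Fin m → E n) → (ℂ →L[ℂ] X)} (hQ : IsSizeKernel A Q)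
    {J : E n → ((Fin m → E n) → ℂ) →ₗ.[ℂ] X} (hJ : IsIntegralExtension Q J)
    {b : Fin m → E n → ℂ} (hb : ∀ N, IsBMO (b N)) {f : Fin m → E n → ℂ}
    (hf : ∀ i, AEStronglyMeasurable (f i) volume) (c : E n) (r : ℝ) (x : E n) :
    iterComm J b f x ≤ iterComm J b (fun i => (Metric.ball c r).indicator (f i)) x +
      ∫⁻ y in (Set.univ.pi fun _ : Fin m => Metric.ball c r)ᶜ,
        ‖Q x y (∏ j, (b j x - b j (y j)) * f j (y j))‖ₑ := by
  have hF : AEStronglyMeasurable (fun y : Fin m → E n =>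
      ∏ j, (b j x - b j (y j)) * f j (y j)) volume :=
    Finset.aestronglyMeasurable_fun_prod _ fun j _ =>
      (aestronglyMeasurable_const.sub
        (aestronglyMeasurable_comp_eval (hb j).1.aestronglyMeasurable j)).mul
        (aestronglyMeasurable_comp_eval (hf j) j)
  have h := valueNorm_le_add_lintegral hJ x (hQ.aestronglyMeasurable_apply x hF)
    (MeasurableSet.univ_pi fun _ : Fin m => measurableSet_ball (x := c) (ε := r))
  refine h.trans (le_of_eq ?_)
  congr 1
  unfold iterComm
  congr 1
  funext y
  simp_rw [Finset.prod_mul_distrib]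
  rw [prod_indicator_eq]
  by_cases hy : y ∈ Set.univ.pi fun _ : Fin m => Metric.ball c r
  · rw [Set.indicator_of_mem hy, Set.indicator_of_mem hy]
  · rw [Set.indicator_of_notMem hy, Set.indicator_of_notMem hy, mul_zero]

theorem enorm_prod_eq (z : Fin m → ℂ) : ‖∏ i, z i‖ₑ = ∏ i, ‖z i‖ₑ := by
  simp [enorm, nnnorm_prod]

theorem enorm_sub_mul_prod_le (b f : Fin m → E n → ℂ) (N : Fin m) (x : E n) (y : Fin m → E n) :
    ‖(b N x - b N (y N)) * ∏ j, f j (y j)‖ₑ ≤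
      ∏ i, ((if i ∈ ({N} : Finset (Fin m)) then ‖b i x - b i (y i)‖ₑ else 1) *
        ‖f i (y i)‖ₑ) := by
  rw [Finset.prod_mul_distrib, enorm_mul, enorm_prod_eq]
  simp

theorem enorm_prod_sub_mul_le (b f : Fin m → E n → ℂ) (x : E n) (y : Fin m → E n) :
    ‖∏ j, (b j x - b j (y j)) * f j (y j)‖ₑ ≤
      ∏ i, ((if i ∈ (Finset.univ : Finset (Fin m)) then ‖b i x - b i (y i)‖ₑ else 1) *
        ‖f i (y i)‖ₑ) := by
  rw [enorm_prod_eq]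
  simp [enorm_mul]

theorem aemeasurable_enorm_sub_add {μ : Measure (E n)} (hμ : μ ≪ volume) {b : E n → ℂ}
    (hb : LocallyIntegrable b volume) (β : ℂ) (M : ℝ≥0) (B : Set (E n)) :
    AEMeasurable (fun x => ‖b x - β‖ₑ + M) (μ.restrict B) :=
  ((((hb.aestronglyMeasurable.sub aestronglyMeasurable_const).enorm).add_const _).mono_ac
    hμ).restrict

end Commutators

/-! ### Assembly of the local and far estimates. -/

section Main

variable {n m : ℕ}

theorem mul_rpow_sub_one_mul {V : ℝ≥0∞} {m : ℕ} (h0 : V ≠ 0) (ht : V ≠ ⊤) (κ : ℝ) :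
    (V ^ m) ^ (κ - 1) * V ^ m = (V ^ m) ^ κ := by
  have h := ENNReal.rpow_add (κ - 1) 1 (pow_ne_zero m h0) (ENNReal.pow_ne_top (n := m) ht)
  rw [ENNReal.rpow_one, sub_add_cancel] at h
  exact h.symm

theorem exists_morreyWeakType_comm (hn : n ≠ 0) (hm : m ≠ 0) {κ : ℝ} (hκ0 : 0 < κ)
    (hκ1 : κ < 1) {w : Fin m → E n → ℝ} (hw : IsMultiA1 w) (hw' : ∀ i, IsAInfty (w i)) (A : ℝ)
    (C₀ : ℝ≥0) : ∃ C : ℝ≥0,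
      ∀ (X : Type*) [NormedAddCommGroup X] [NormedSpace ℂ X]
        (Q : E n → (Fin m → E n) → (ℂ →L[ℂ] X)) (J : E n → ((Fin m → E n) → ℂ) →ₗ.[ℂ] X)
        (b : Fin m → E n → ℂ), IsSizeKernel A Q → IsIntegralExtension Q J →
        (∀ N, IsBMO (b N)) →
        LebesgueWeakType w Phi (C₀ * ENNReal.ofReal (Phi (bmoNormVec b))) (comm J b) →
        MorreyWeakType κ w Phi (C * ENNReal.ofReal (Phi (bmoNormVec b))) (comm J b) := by
  obtain ⟨C₁, hC₁⟩ := exists_prod_lintegral_indicator_le hm hκ0.le hw hw' 1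
  obtain ⟨C₂, hC₂⟩ := exists_lintegral_far_le hn hm hκ0 hκ1 hw hw' A
  obtain ⟨C₃, hC₃1, hC₃⟩ := hw.exists_ballComparable hm
  have hac : wMeasure (nu w) ≪ volume := withDensity_absolutelyContinuous _ _
  obtain ⟨C₄, hC₄⟩ := exists_lintegral_sub_average_add_le hac hC₃
    fun c r hr => hw.wMeasure_nu_ball_ne_top hm c hr
  refine ⟨2 ^ m * (C₀ * C₁ + 2 ^ m * C₂ * (m * C₄)), ?_⟩
  intro X _ _ Q J b hQ hJ hb hweak f hf l hl c r hr
  have hV0 := wMeasure_nu_ball_ne_zero hw.1 c hr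
  have hVt := hw.wMeasure_nu_ball_ne_top hm c hr
  set V := wMeasure (nu w) (Metric.ball c r) with hV
  have hnorm0 : 0 ≤ bmoNormVec b := ENNReal.toReal_nonneg
  -- John-Nirenberg is normalized by a positive bound `M`. For norm zero the hypothesis itself has
  -- right side zero, since `Φ(0) = 0`, and the level set is null.
  rcases hnorm0.eq_or_lt with hzero | hpos
  · have h := hweak f hf l hl
    rw [← hzero, Phi_zero, ENNReal.ofReal_zero, mul_zero, zero_mul, nonpos_iff_eq_zero,
      pow_eq_zero_iff hm] at h
    have h' : wMeasure (nu w)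
        {x | x ∈ Metric.ball c r ∧ ENNReal.ofReal (l ^ m) < comm J b f x} = 0 :=
      measure_mono_null (fun x hx => hx.2) h
    rw [h', zero_pow hm, mul_zero]
    exact zero_le
  set M : ℝ≥0 := (bmoNormVec b).toNNReal with hMdef
  have hM : 0 < M := Real.toNNReal_pos.mpr hpos
  have hbM := bmoNorm_le_toNNReal_bmoNormVec hb
  -- The far part is linear in the norm of the symbols, and `t ≤ Φ(t)` absorbs it into the required
  -- factor.
  have hMPhi : (M : ℝ≥0∞) ≤ ENNReal.ofReal (Phi (bmoNormVec b)) :=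
    ENNReal.ofReal_le_ofReal (le_Phi hnorm0)
  set K := ENNReal.ofReal (Phi (bmoNormVec b)) with hK
  set G := ∏ i, morreyLLogL κ (w i) fun x => Phi (‖f i x‖ / l) with hG
  set Z : Fin m → E n → ℝ≥0∞ := fun i x => ‖b i x - ⨍ y in Metric.ball c r, b i y‖ₑ + M with hZ
  have hlocal := hweak (fun i => (Metric.ball c (2 * r)).indicator (f i))
    (fun i => aestronglyMeasurable_indicator (hf i) c (2 * r)) (l / 2) (by positivity)
  have hfar := measure_pow_le_of_sum (μ := wMeasure (nu w)) hm (B := Metric.ball c r) (Z := Z)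
    (fun i => aemeasurable_enorm_sub_add hac (hb i).1 _ M _) (K := C₄ * M)
    (fun i => hC₄ (b i) (hb i).1 M hM (hbM i) c r hr)
    (D := C₂ * (V ^ m) ^ (κ - 1) * G) hl
    (R := fun x => ∑ N, ∫⁻ y in (Set.univ.pi fun _ : Fin m => Metric.ball c (2 * r))ᶜ,
        ‖Q x y ((b N x - b N (y N)) * ∏ j, f j (y j))‖ₑ) (fun x hx => by
      rw [Finset.mul_sum, Finset.mul_sum]
      refine Finset.sum_le_sum fun N _ => ?_
      refine (hC₂ X Q hQ b (fun i => (hb i).1) M hM hbM f hf l hl 1 c r hr x hx {N} _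
        (enorm_sub_mul_prod_le b f N x)).trans (le_of_eq ?_)
      simp [hG, hZ, hV])
  refine (rpow_mul_measure_pow_le hm (κ := κ) hV0 hVt
    (S₀ := comm J b fun i => (Metric.ball c (2 * r)).indicator (f i))
    (R := fun x => ∑ N, ∫⁻ y in (Set.univ.pi fun _ : Fin m => Metric.ball c (2 * r))ᶜ,
        ‖Q x y ((b N x - b N (y N)) * ∏ j, f j (y j))‖ₑ)
    (fun x _ => ?_) hl (K₁ := C₀ * K * C₁) (K₂ := 2 ^ m * C₂ * (m * C₄) * K) (G := G)
    ?_ ?_).trans (le_of_eq ?_)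
  · unfold comm
    rw [← Finset.sum_add_distrib]
    exact Finset.sum_le_sum fun N _ => commN_le hQ hJ hb hf N c (2 * r) x
  · calc _ ≤ _ := hlocal
      _ ≤ C₀ * K * (C₁ * (V ^ m) ^ κ * G) := mul_le_mul_right (hC₁ f l hl c r hr) _
      _ = _ := by ring
  · calc _ ≤ _ := hfar
      _ = 2 ^ m * C₂ * (m * C₄) * M * ((V ^ m) ^ (κ - 1) * V ^ m) * G := by ring
      _ ≤ _ := by
        rw [mul_rpow_sub_one_mul hV0 hVt]
        gcongr
  · push_cast
    ring

theorem exists_morreyWeakType_iterComm (hn : n ≠ 0) (hm : m ≠ 0) {κ : ℝ} (hκ0 : 0 < κ)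
    (hκ1 : κ < 1) {w : Fin m → E n → ℝ} (hw : IsMultiA1 w) (hw' : ∀ i, IsAInfty (w i)) (A : ℝ)
    (C₀ : ℝ≥0) (k : ℕ) (M₀ : ℝ) : ∃ C : ℝ≥0,
      ∀ (X : Type*) [NormedAddCommGroup X] [NormedSpace ℂ X]
        (Q : E n → (Fin m → E n) → (ℂ →L[ℂ] X)) (J : E n → ((Fin m → E n) → ℂ) →ₗ.[ℂ] X)
        (b : Fin m → E n → ℂ), IsSizeKernel A Q → IsIntegralExtension Q J →
        (∀ N, IsBMO (b N)) → bmoNormVec b ≤ M₀ →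
        LebesgueWeakType w (Phi^[k]) C₀ (iterComm J b) →
        MorreyWeakType κ w (Phi^[k]) C (iterComm J b) := by
  obtain ⟨C₁, hC₁⟩ := exists_prod_lintegral_indicator_le hm hκ0.le hw hw' k
  obtain ⟨C₂, hC₂⟩ := exists_lintegral_far_le hn hm hκ0 hκ1 hw hw' A
  obtain ⟨C₃, hC₃1, hC₃⟩ := hw.exists_ballComparable hm
  have hac : wMeasure (nu w) ≪ volume := withDensity_absolutelyContinuous _ _
  obtain ⟨C₄, hC₄⟩ := exists_lintegral_sub_average_add_le hac hC₃
    fun c r hr => hw.wMeasure_nu_ball_ne_top hm c hr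
  -- Here the constant may depend on the bound for the symbols, so any positive majorant will do and
  -- the case of norm zero needs no separate treatment.
  set M : ℝ≥0 := M₀.toNNReal + 1 with hMdef
  refine ⟨2 ^ m * (C₀ * C₁ + 2 ^ m * C₂ * (C₄ * M) ^ m), ?_⟩
  intro X _ _ Q J b hQ hJ hb hbM₀ hweak f hf l hl c r hr
  have hV0 := wMeasure_nu_ball_ne_zero hw.1 c hr
  have hVt := hw.wMeasure_nu_ball_ne_top hm c hr
  set V := wMeasure (nu w) (Metric.ball c r) with hV
  have hM : 0 < M := by positivity
  have hbM : ∀ i, bmoNorm (b i) ≤ M := fun i => (bmoNorm_le_toNNReal_bmoNormVec hb i).trans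
    (by exact_mod_cast (Real.toNNReal_le_toNNReal hbM₀).trans le_self_add)
  set G := ∏ i, morreyLLogL κ (w i) fun x => Phi^[k] (‖f i x‖ / l) with hG
  set Z : Fin m → E n → ℝ≥0∞ := fun i x => ‖b i x - ⨍ y in Metric.ball c r, b i y‖ₑ + M with hZ
  have hlocal := hweak (fun i => (Metric.ball c (2 * r)).indicator (f i))
    (fun i => aestronglyMeasurable_indicator (hf i) c (2 * r)) (l / 2) (by positivity)
  have hfar := measure_pow_le_of_prod (μ := wMeasure (nu w)) hm (B := Metric.ball c r) (Z := Z)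
    (fun i => aemeasurable_enorm_sub_add hac (hb i).1 _ M _) (K := C₄ * M)
    (fun i => hC₄ (b i) (hb i).1 M hM (hbM i) c r hr)
    (D := C₂ * (V ^ m) ^ (κ - 1) * G) hl
    (R := fun x => ∫⁻ y in (Set.univ.pi fun _ : Fin m => Metric.ball c (2 * r))ᶜ,
        ‖Q x y (∏ j, (b j x - b j (y j)) * f j (y j))‖ₑ) (fun x hx => by
      refine (hC₂ X Q hQ b (fun i => (hb i).1) M hM hbM f hf l hl k c r hr x hx Finset.univ _
        (enorm_prod_sub_mul_le b f x)).trans (le_of_eq ?_)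
      simp [hG, hZ, hV])
  refine (rpow_mul_measure_pow_le hm (κ := κ) hV0 hVt
    (S₀ := iterComm J b fun i => (Metric.ball c (2 * r)).indicator (f i))
    (R := fun x => ∫⁻ y in (Set.univ.pi fun _ : Fin m => Metric.ball c (2 * r))ᶜ,
        ‖Q x y (∏ j, (b j x - b j (y j)) * f j (y j))‖ₑ)
    (fun x _ => iterComm_le hQ hJ hb hf c (2 * r) x) hl (K₁ := C₀ * C₁)
    (K₂ := 2 ^ m * C₂ * (C₄ * M) ^ m) (G := G) ?_ ?_).trans (le_of_eq ?_)
  · calc _ ≤ _ := hlocal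
      _ ≤ C₀ * (C₁ * (V ^ m) ^ κ * G) := mul_le_mul_right (hC₁ f l hl c r hr) _
      _ = _ := by ring
  · calc _ ≤ _ := hfar
      _ = 2 ^ m * C₂ * (C₄ * M) ^ m * ((V ^ m) ^ (κ - 1) * V ^ m) * G := by ring
      _ ≤ _ := by rw [mul_rpow_sub_one_mul hV0 hVt]
  · push_cast
    ring

end Main

end MorreyLLogL

theorem theorem3 (n m : ℕ) (hn : 1 ≤ n) (hm : 2 ≤ m) (κ : ℝ) (hκ0 : 0 < κ) (hκ1 : κ < 1)
    (w : Fin m → MorreyLLogL.E n → ℝ)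
    (hw : MorreyLLogL.IsMultiA1 w) (hw' : ∀ i, MorreyLLogL.IsAInfty (w i)) :
    (∀ (A : ℝ) (C₀ : ℝ≥0), ∃ C : ℝ≥0,
      ∀ (X : Type*) [NormedAddCommGroup X] [NormedSpace ℂ X] [CompleteSpace X]
        (Q : MorreyLLogL.E n → (Fin m → MorreyLLogL.E n) → (ℂ →L[ℂ] X))
        (J : MorreyLLogL.E n → ((Fin m → MorreyLLogL.E n) → ℂ) →ₗ.[ℂ] X)
        (b : Fin m → MorreyLLogL.E n → ℂ),
        MorreyLLogL.IsSizeKernel A Q → MorreyLLogL.IsIntegralExtension Q J →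
        (∀ N, MorreyLLogL.IsBMO (b N)) →
        MorreyLLogL.LebesgueWeakType w MorreyLLogL.Phi
          (C₀ * ENNReal.ofReal (MorreyLLogL.Phi (MorreyLLogL.bmoNormVec b)))
          (MorreyLLogL.comm J b) →
        MorreyLLogL.MorreyWeakType κ w MorreyLLogL.Phi
          (C * ENNReal.ofReal (MorreyLLogL.Phi (MorreyLLogL.bmoNormVec b)))
          (MorreyLLogL.comm J b)) ∧
    (∀ (A : ℝ) (C₀ : ℝ≥0) (M : ℝ), ∃ C : ℝ≥0,
      ∀ (X : Type*) [NormedAddCommGroup X] [NormedSpace ℂ X] [CompleteSpace X]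
        (Q : MorreyLLogL.E n → (Fin m → MorreyLLogL.E n) → (ℂ →L[ℂ] X))
        (J : MorreyLLogL.E n → ((Fin m → MorreyLLogL.E n) → ℂ) →ₗ.[ℂ] X)
        (b : Fin m → MorreyLLogL.E n → ℂ),
        MorreyLLogL.IsSizeKernel A Q → MorreyLLogL.IsIntegralExtension Q J →
        (∀ N, MorreyLLogL.IsBMO (b N)) → MorreyLLogL.bmoNormVec b ≤ M →
        MorreyLLogL.LebesgueWeakType w (MorreyLLogL.Phi^[m]) C₀ (MorreyLLogL.iterComm J b) →
        MorreyLLogL.MorreyWeakType κ w (MorreyLLogL.Phi^[m]) C (MorreyLLogL.iterComm J b)) := by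
  refine ⟨fun A C₀ => ?_, fun A C₀ M => ?_⟩
  · obtain ⟨C, hC⟩ := MorreyLLogL.exists_morreyWeakType_comm (by omega) (by omega) hκ0 hκ1 hw hw'
      A C₀
    exact ⟨C, fun X _ _ _ => hC X⟩
  · obtain ⟨C, hC⟩ := MorreyLLogL.exists_morreyWeakType_iterComm (by omega) (by omega) hκ0 hκ1
      hw hw' A C₀ m M
    exact ⟨C, fun X _ _ _ => hC X⟩
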